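/- There exist absolute constants $C_0, c_0, K_0>0$ such that the following holds. Let $n\ge 1$, and let $\xi$ be an integer-valued random variable (not assumed to be bounded). Define $\alpha$ by $$\max_{x\in\mathbb Z}\mathbb P(\xi=x)=1-\alpha,$$ and assume that $$1-\alpha\le 1-\frac{C_0\log n}{n}.$$ Let $M=(x_{ij})_{1\le i,j\le n}$ be a random matrix with $x_{ii}=0$ whose off-diagonal entries $x_{ij}$, $i\neq j$, are i.i.d. copies of $\xi$, and let $L=(L_{ij})_{1\le i,j\le n}$ be its Laplacian, that is, $L_{ij}=-x_{ij}$ for $i\ne j$ and $L_{ii}=\sum_{k=1}^n x_{ki}$. Then, with probability at least $1-K_0e^{-c_0\alpha n}$, every $n\times(n-1)$ matrix formed by $n-1$ of the columns of $L$ has rank $n-1$ over $\mathbb R$. -/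

import Mathlib

open MeasureTheory ProbabilityTheory

/-- The Laplacian of a square integer matrix `M = (x_{ij})`: the off-diagonal entries are
`-x_{ij}` and the `i`-th diagonal entry is the `i`-th column sum `∑ k, x_{ki}`. -/
def digraphLaplacian {n : ℕ} (M : Matrix (Fin n) (Fin n) ℤ) : Matrix (Fin n) (Fin n) ℤ :=
  Matrix.of fun i j => if i = j then ∑ k, M k i else - M i j

/-- The columns of the integer matrix `A` with indices in `S`, regarded as a real matrix. -/
def realColumns {n : ℕ} (A : Matrix (Fin n) (Fin n) ℤ) (S : Finset (Fin n)) :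
    Matrix (Fin n) S ℝ :=
  Matrix.of fun i j => (A i j : ℝ)

/-- `M` is a random `n × n` integer matrix with zero diagonal, whose off-diagonal entries are
independent and all have the law `ν`. -/
structure IsRandomDigraphMatrix {Ω : Type*} [MeasurableSpace Ω] {n : ℕ}
    (M : Ω → Matrix (Fin n) (Fin n) ℤ) (ν : Measure ℤ) (P : Measure Ω) : Prop where
  diag_eq_zero : ∀ ω i, M ω i i = 0
  indep : iIndepFun (fun (e : {e : Fin n × Fin n // e.1 ≠ e.2}) ω => M ω e.1.1 e.1.2) P
  law : ∀ i j, i ≠ j → HasLaw (fun ω => M ω i j) ν P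

open MeasureTheory ProbabilityTheory

namespace LaplacianRank

/-! Fix the omitted column `j₀` and delete the row `j₀` as well. It suffices that the remaining
square matrix of size `N = n - 1` is nonsingular modulo one prime `p`; a union bound over `j₀` costs
only a factor `n`. Truncating the law to a large interval and taking `p` larger than its length
keeps all atoms modulo `p` at most `1 - a` with `a = α / 2`, and `p` may also be taken at least `exp
N` (`exists_prime_modWeight_le`). Since diagonal entries are column sums, the columns are
independent; up to sign, column `j` is the image of an i.i.d. vector under the involution `colMap`.
A linear form `w` in column `j` becomes a form in i.i.d. variables with coefficients `w k - w j` for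
`k ≠ j` and `-w j` at `j`. So the structured normals are the nearly constant vectors, not just the
sparse ones, and `Spread` excludes them.

The columns are revealed one at a time, and one bounds the probability that the next falls into the
span of its predecessors. While fewer than `3N/4` are present, Odlyzko's bound `mass_coset_le` is
enough. Later there are three possibilities.

A normal of the span is nearly constant. `mass_exists_not_spread_le` excludes this by a union bound
over exceptional sets `S`; for each `S`, the potential `L ^ dim` of the space of candidate normals
contracts on average with every new column outside `S` (`mass_exists_normal_le`).

Some normal is spread and its hyperplane has small mass for every column law. Then the next column
is unlikely to fall into the span.

All normals are spread and each hyperplane is heavy for some column law (`badSet`). This property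
survives adding independent columns, so it can be carried up to `N - 1` columns at bounded cost
(`mass_badSet_le_exp`). There the span is a hyperplane, and the Kahn–Komlós–Szemerédi swap
`mass_span_mem_le` applies: a Halász-type comparison (`mass_le_mass_lazy`, via Fourier analysis and
Cauchy–Davenport) shows that lazy symmetrised columns hit the hyperplane far more often than the
true ones. Exchanging half of the columns for lazy ones gives an exponentially small bound.

The hypothesis `α n ≥ C₀ log n` pays for polynomial factors and for nearly constant normals with few
exceptional coordinates. -/

/-- The total weight of the set `A` under the weight function `f` on a finite type. -/
noncomputable def mass {X : Type*} [Fintype X] (f : X → ℝ) (A : Set X) : ℝ :=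
  ∑ x, A.indicator f x

/-- A probability weight on a finite type. -/
structure IsProbWeight {X : Type*} [Fintype X] (f : X → ℝ) : Prop where
  nonneg : ∀ x, 0 ≤ f x
  sum_eq_one : ∑ x, f x = 1

/-- The product weight on tuples. -/
def tupleWeight {ι E : Type*} [Fintype ι] (w : ι → E → ℝ) (x : ι → E) : ℝ :=
  ∏ i, w i (x i)

/-! ### Finite probability weights. -/

section Mass

variable {X Y : Type*} [Fintype X] [Fintype Y] {f : X → ℝ} {A B : Set X}

lemma mass_univ (hf : IsProbWeight f) : mass f Set.univ = 1 := by
  simp [mass, hf.sum_eq_one]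

lemma mass_nonneg (hf : IsProbWeight f) (A : Set X) : 0 ≤ mass f A :=
  Finset.sum_nonneg fun x _ => Set.indicator_nonneg (fun x _ => hf.nonneg x) x

lemma mass_mono (hf : IsProbWeight f) (h : A ⊆ B) : mass f A ≤ mass f B :=
  Finset.sum_le_sum fun x _ => Set.indicator_le_indicator_of_subset h hf.nonneg x

lemma mass_le_one (hf : IsProbWeight f) (A : Set X) : mass f A ≤ 1 :=
  (mass_mono hf (Set.subset_univ A)).trans (mass_univ hf).le

lemma mass_compl (hf : IsProbWeight f) (A : Set X) : mass f Aᶜ = 1 - mass f A := by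
  rw [← mass_univ hf]
  simp only [mass, ← Finset.sum_sub_distrib, Set.indicator_univ, Set.indicator_compl, Pi.sub_apply]

lemma mass_union_le (hf : IsProbWeight f) (A B : Set X) : mass f (A ∪ B) ≤ mass f A + mass f B := by
  simp only [mass, ← Finset.sum_add_distrib]
  refine Finset.sum_le_sum fun x _ => ?_
  by_cases hA : x ∈ A <;> by_cases hB : x ∈ B <;> simp [hA, hB, hf.nonneg x]

lemma mass_le_add_diff (hf : IsProbWeight f) (A B : Set X) : mass f A ≤ mass f B + mass f (A \ B) :=
  (mass_mono hf (fun x hx => by by_cases h : x ∈ B <;> simp [h, hx])).trans (mass_union_le hf _ _)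

lemma mass_le_sum (hf : IsProbWeight f) {ι : Type*} (s : Finset ι) (A : Set X) (B : ι → Set X)
    (h : ∀ x ∈ A, ∃ i ∈ s, x ∈ B i) : mass f A ≤ ∑ i ∈ s, mass f (B i) := by
  unfold mass
  rw [Finset.sum_comm]
  refine Finset.sum_le_sum fun x _ => ?_
  have h0 : ∀ i ∈ s, 0 ≤ (B i).indicator f x :=
    fun i _ => Set.indicator_nonneg (fun x _ => hf.nonneg x) x
  by_cases hx : x ∈ A
  · obtain ⟨i, hi, hxi⟩ := h x hx
    rw [Set.indicator_of_mem hx, ← Set.indicator_of_mem hxi f]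
    exact Finset.single_le_sum (f := fun i => (B i).indicator f x) h0 hi
  · rw [Set.indicator_of_notMem hx]
    exact Finset.sum_nonneg h0

lemma sum_mass_fiber_le (hf : IsProbWeight f) {β : Type*} (g : X → β) (s : Finset β) :
    ∑ b ∈ s, mass f {x | g x = b} ≤ 1 := by
  classical
  unfold mass
  rw [Finset.sum_comm, ← hf.sum_eq_one]
  refine Finset.sum_le_sum fun x _ => ?_
  simp only [Set.indicator_apply, Set.mem_ofPred_eq, Finset.sum_ite_eq]
  split_ifs
  · exact le_rfl
  · exact hf.nonneg x

lemma mass_eq_sum_fiber {β : Type*} (f : X → ℝ) (g : X → β) (s : Finset β) :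
    mass f {x | g x ∈ s} = ∑ b ∈ s, mass f {x | g x = b} := by
  classical
  unfold mass
  rw [Finset.sum_comm]
  refine Finset.sum_congr rfl fun x _ => ?_
  simp [Set.indicator_apply]

lemma mass_comp_equiv (e : Y ≃ X) (f : X → ℝ) (A : Set X) :
    mass (f ∘ e) (e ⁻¹' A) = mass f A := by
  unfold mass
  exact Fintype.sum_equiv e _ _ fun y => rfl

lemma IsProbWeight.comp_equiv (hf : IsProbWeight f) (e : Y ≃ X) : IsProbWeight (f ∘ e) where
  nonneg y := hf.nonneg _
  sum_eq_one := by rw [← hf.sum_eq_one]; exact Fintype.sum_equiv e _ _ fun y => rfl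

end Mass

/-! ### Product weights and independence of coordinates. -/

section Tuple

variable {ι E : Type*} [Fintype ι] [DecidableEq ι] [Fintype E] {w : ι → E → ℝ}

lemma sum_tupleWeight (w : ι → E → ℝ) : ∑ x, tupleWeight w x = ∏ i, ∑ e, w i e := by
  rw [Finset.prod_univ_sum, Fintype.piFinset_univ]; rfl

lemma isProbWeight_tupleWeight (hw : ∀ i, IsProbWeight (w i)) : IsProbWeight (tupleWeight w) where
  nonneg x := Finset.prod_nonneg fun i _ => (hw i).nonneg _
  sum_eq_one := by
    rw [sum_tupleWeight]
    exact Finset.prod_eq_one fun i _ => (hw i).sum_eq_one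

/-- Coordinates outside `I` are independent of an event that is determined by those in `I`. -/
lemma mass_inter_pi [Nonempty E] (hw : ∀ i, IsProbWeight (w i)) (I : Finset ι) (A : Set (ι → E))
    (hA : ∀ x y, (∀ i ∈ I, x i = y i) → (x ∈ A ↔ y ∈ A)) (V : Set E) :
    mass (tupleWeight w) (A ∩ {x | ∀ i, i ∉ I → x i ∈ V}) =
      mass (tupleWeight w) A * ∏ i ∈ Iᶜ, mass (w i) V := by
  classical
  obtain ⟨e₀⟩ := ‹Nonempty E›
  let e := (Equiv.piEquivPiSubtypeProd (fun i => i ∈ I) (fun _ => E)).symm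
  -- The first factor does not depend on `B`. Taking `B` to be everything identifies it with the
  -- mass of `A`; `e₀` is mere padding outside `I`.
  have key : ∀ (B : {i // i ∉ I} → Set E),
      mass (tupleWeight w) (A ∩ {x | ∀ i (hi : i ∉ I), x i ∈ B ⟨i, hi⟩}) =
      (∑ z : {i // i ∈ I} → E, if e (z, fun _ => e₀) ∈ A then ∏ i : {i // i ∈ I}, w i (z i) else 0) *
        ∏ i : {i // i ∉ I}, mass (w i) (B i) := by
    intro B
    simp only [mass]
    rw [Finset.prod_univ_sum, Fintype.piFinset_univ, ← e.sum_comp, Fintype.sum_prod_type,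
      Finset.sum_mul_sum]
    refine Finset.sum_congr rfl fun z _ => Finset.sum_congr rfl fun z' _ => ?_
    have h1 : e (z, z') ∈ A ↔ e (z, fun _ => e₀) ∈ A := by
      refine hA _ _ fun i hi => ?_
      simp [e, Equiv.piEquivPiSubtypeProd, hi]
    have h2 : tupleWeight w (e (z, z')) =
        (∏ i : {i // i ∈ I}, w i (z i)) * ∏ i : {i // i ∉ I}, w i (z' i) := by
      rw [tupleWeight, ← Fintype.prod_subtype_mul_prod_subtype (fun i => i ∈ I)]
      congr 1
      · exact Finset.prod_congr (by ext; simp) fun i _ => by simp [e, Equiv.piEquivPiSubtypeProd, i.2]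
      · exact Finset.prod_congr (by ext; simp) fun i _ => by simp [e, Equiv.piEquivPiSubtypeProd, i.2]
    have h3 : (∀ i (hi : i ∉ I), e (z, z') i ∈ B ⟨i, hi⟩) ↔ ∀ i : {i // i ∉ I}, z' i ∈ B i := by
      simp +contextual [e, Equiv.piEquivPiSubtypeProd]
    have h4 : e (z, z') ∈ A ∩ {x | ∀ i (hi : i ∉ I), x i ∈ B ⟨i, hi⟩} ↔
        e (z, fun _ => e₀) ∈ A ∧ ∀ i : {i // i ∉ I}, z' i ∈ B i :=
      and_congr h1 h3
    by_cases hz : e (z, fun _ => e₀) ∈ A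
    · rw [if_pos hz]
      by_cases h : ∀ i : {i // i ∉ I}, z' i ∈ B i
      · rw [Set.indicator_of_mem (h4.2 ⟨hz, h⟩), h2]
        congr 1
        exact Finset.prod_congr rfl fun i _ => by rw [Set.indicator_of_mem (h i)]
      · rw [Set.indicator_of_notMem fun h' => h (h4.1 h').2]
        push Not at h
        obtain ⟨i, hi⟩ := h
        rw [Finset.prod_eq_zero (Finset.mem_univ i) (Set.indicator_of_notMem hi _), mul_zero]
    · rw [if_neg hz, Set.indicator_of_notMem fun h' => hz (h4.1 h').1, zero_mul]
  have h1 := key fun _ => V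
  have h2 := key fun _ => Set.univ
  simp only [Set.mem_univ, implies_true, Set.ofPred_true, Set.inter_univ, mass_univ (hw _),
    Finset.prod_const_one, mul_one] at h2
  rw [h1, h2]
  congr 1
  exact (Finset.prod_subtype _ (by simp) fun i => mass (w i) V).symm

end Tuple

/-! ### Revealing an independent sequence term by term. -/

section Prefix

variable {E : Type*} [Fintype E] {w : ℕ → E → ℝ}

/-- The joint weight of the first `k` terms of an independent sequence. -/
def prefixWeight (w : ℕ → E → ℝ) (k : ℕ) : (Fin k → E) → ℝ := tupleWeight fun i : Fin k => w i

lemma isProbWeight_prefixWeight {k : ℕ} (hw : ∀ i < k, IsProbWeight (w i)) :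
    IsProbWeight (prefixWeight w k) :=
  isProbWeight_tupleWeight fun i => hw i i.2

lemma mass_prefixWeight_cons (w : ℕ → E → ℝ) (k : ℕ) (A : Set (Fin (k + 1) → E)) :
    mass (prefixWeight w (k + 1)) A =
      ∑ c, w 0 c * mass (prefixWeight (fun i => w (i + 1)) k) {x | Fin.cons c x ∈ A} := by
  classical
  unfold mass
  rw [← (Fin.consEquiv fun _ : Fin (k + 1) => E).sum_comp, Fintype.sum_prod_type]
  refine Finset.sum_congr rfl fun c _ => ?_
  rw [Finset.mul_sum]
  refine Finset.sum_congr rfl fun x _ => ?_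
  simp [Set.indicator_apply, Fin.consEquiv, prefixWeight, tupleWeight, Fin.prod_univ_succ]

lemma mass_prefixWeight_snoc (w : ℕ → E → ℝ) (k : ℕ) (A : Set (Fin (k + 1) → E)) :
    mass (prefixWeight w (k + 1)) A =
      ∑ x, prefixWeight w k x * mass (w k) {c | (Fin.snoc x c : Fin (k + 1) → E) ∈ A} := by
  classical
  unfold mass
  rw [← (Fin.snocEquiv fun _ : Fin (k + 1) => E).sum_comp, Fintype.sum_prod_type, Finset.sum_comm]
  refine Finset.sum_congr rfl fun x _ => ?_
  rw [Finset.mul_sum]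
  refine Finset.sum_congr rfl fun c _ => ?_
  simp [Set.indicator_apply, Fin.snocEquiv, prefixWeight, tupleWeight, Fin.prod_univ_castSucc]

end Prefix

/-! ### Atoms of linear forms and Odlyzko's bound. -/

section Atoms

variable {F : Type*} [Fintype F] {q : F → ℝ} {a : ℝ}

/-- The weight of a vector with independent entries of weight `q`. -/
def iidWeight (q : F → ℝ) (N : ℕ) : (Fin N → F) → ℝ := prefixWeight (fun _ => q) N

lemma isProbWeight_iidWeight (hq : IsProbWeight q) (N : ℕ) : IsProbWeight (iidWeight q N) :=
  isProbWeight_prefixWeight fun _ _ => hq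

variable [Field F]

/-- Bound for the atoms of a linear form in independent variables, by the number of its nonzero
coefficients. -/
lemma mass_linearForm_le (hq : IsProbWeight q) (ha : a ≤ 1 / 2) (hqa : ∀ r, q r ≤ 1 - a) [DecidableEq F]
    {N : ℕ} (u : Fin N → F) (b : F) :
    mass (iidWeight q N) {z | u ⬝ᵥ z = b} ≤
      (1 + (1 - 2 * a) ^ (Finset.univ.filter fun k => u k ≠ 0).card) / 2 := by
  induction N generalizing b with
  | zero =>
    have := mass_le_one (isProbWeight_iidWeight hq 0) {z | u ⬝ᵥ z = b}
    simpa using this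
  | succ N ih =>
    set s := (Finset.univ.filter fun k : Fin N => u k.succ ≠ 0).card with hs
    set m : F → ℝ := fun b => mass (iidWeight q N) {z | (fun k => u k.succ) ⬝ᵥ z = b} with hm
    set Q : ℝ := (1 + (1 - 2 * a) ^ s) / 2 with hQ
    have hpow : 0 ≤ (1 - 2 * a) ^ s := pow_nonneg (by linarith) _
    have hm0 : ∀ b, 0 ≤ m b := fun b => mass_nonneg (isProbWeight_iidWeight hq N) _
    have hmQ : ∀ b, m b ≤ Q := fun b => ih _ b
    have hm2 : ∀ b b', b ≠ b' → m b + m b' ≤ 1 := by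
      intro b b' hbb
      have := sum_mass_fiber_le (isProbWeight_iidWeight hq N)
        (fun z => (fun k => u k.succ) ⬝ᵥ z) {b, b'}
      rwa [Finset.sum_pair hbb] at this
    have hrec : mass (iidWeight q (N + 1)) {z | u ⬝ᵥ z = b} = ∑ c, q c * m (b - u 0 * c) := by
      unfold iidWeight
      rw [mass_prefixWeight_cons]
      refine Finset.sum_congr rfl fun c _ => ?_
      congr 2
      ext z
      simp only [Set.mem_ofPred_eq, dotProduct, Fin.sum_univ_succ, Fin.cons_zero, Fin.cons_succ]
      rw [eq_sub_iff_add_eq, add_comm]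
    rw [hrec]
    by_cases h0 : u 0 = 0
    · have hcard : (Finset.univ.filter fun k => u k ≠ 0).card = s := by
        rw [Fin.card_filter_univ_succ]; simp [h0, hs]
      rw [hcard]
      simp only [h0, zero_mul, sub_zero, ← Finset.sum_mul, hq.sum_eq_one, one_mul]
      exact hmQ b
    · have hcard : (Finset.univ.filter fun k => u k ≠ 0).card = s + 1 := by
        rw [Fin.card_filter_univ_succ]; simp [h0, hs]
      rw [hcard, pow_succ]
      -- If `b₀` is an atom of mass at least one half, every other atom has mass at most `1 - m b₀`,
      -- and averaging over the new variable shrinks the excess `2 m b₀ - 1` by a factor `1 - 2a`.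
      -- Otherwise all atoms are below one half already.
      by_cases hbig : ∃ b₀, 1 / 2 ≤ m b₀
      · obtain ⟨b₀, hb₀⟩ := hbig
        set c₀ := (b - b₀) / u 0 with hc₀
        have hc : ∀ c, b - u 0 * c = b₀ ↔ c = c₀ := by
          intro c
          rw [hc₀, eq_div_iff h0, sub_eq_iff_eq_add, eq_sub_iff_add_eq, mul_comm, eq_comm, add_comm]
        have hle : ∑ c, q c * m (b - u 0 * c) ≤
            ∑ c, (q c * (1 - m b₀) + if c = c₀ then q c * (2 * m b₀ - 1) else 0) := by
          refine Finset.sum_le_sum fun c _ => ?_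
          split_ifs with h
          · rw [(hc c).2 h]; nlinarith
          · have h1 := hm2 _ b₀ (fun h' => h ((hc c).1 h'))
            have := mul_le_mul_of_nonneg_left (show m (b - u 0 * c) ≤ 1 - m b₀ by linarith)
              (hq.nonneg c)
            linarith
        rw [Finset.sum_add_distrib, ← Finset.sum_mul, hq.sum_eq_one, Finset.sum_ite_eq'] at hle
        simp only [Finset.mem_univ, if_true] at hle
        have h1 := mul_le_mul_of_nonneg_right (hqa c₀) (show 0 ≤ 2 * m b₀ - 1 by linarith)
        have h2 : (1 - 2 * a) * (2 * m b₀ - 1) ≤ (1 - 2 * a) * (2 * Q - 1) :=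
          mul_le_mul_of_nonneg_left (by linarith [hmQ b₀]) (by linarith)
        have h3 : 2 * Q - 1 = (1 - 2 * a) ^ s := by rw [hQ]; ring
        rw [h3] at h2
        nlinarith
      · push Not at hbig
        have : ∑ c, q c * m (b - u 0 * c) ≤ ∑ c, q c * (1 / 2) :=
          Finset.sum_le_sum fun c _ => mul_le_mul_of_nonneg_left (hbig _).le (hq.nonneg c)
        rw [← Finset.sum_mul, hq.sum_eq_one] at this
        have h2 : 0 ≤ (1 - 2 * a) ^ s * (1 - 2 * a) := mul_nonneg hpow (by linarith)
        linarith

/-- Odlyzko's bound for the probability that a vector with independent entries lies in a coset of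
a given subspace. -/
lemma mass_coset_le (hq : IsProbWeight q) (ha1 : a ≤ 1) (hqa : ∀ r, q r ≤ 1 - a)
    {N : ℕ} (V : Submodule F (Fin N → F)) (b : Fin N → F) :
    mass (iidWeight q N) {z | z - b ∈ V} ≤ (1 - a) ^ (N - Module.finrank F V) := by
  induction N with
  | zero =>
    have := mass_le_one (isProbWeight_iidWeight hq 0) {z | z - b ∈ V}
    simpa using this
  | succ N ih =>
    -- the slice of `V` by vanishing first coordinate
    let incl : (Fin N → F) →ₗ[F] (Fin (N + 1) → F) :=
      { toFun := fun z => Fin.cons 0 z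
        map_add' := fun x y => by ext i; refine Fin.cases ?_ (fun i => ?_) i <;> simp
        map_smul' := fun c x => by ext i; refine Fin.cases ?_ (fun i => ?_) i <;> simp }
    have hincl : Function.Injective incl := fun x y h =>
      Fin.cons_right_injective (α := fun _ : Fin (N + 1) => F) 0 h
    let V' := V.comap incl
    let proj : (Fin (N + 1) → F) →ₗ[F] F := LinearMap.proj 0
    have hVmap : V'.map incl = V ⊓ LinearMap.ker proj := by
      ext z
      simp only [Submodule.mem_map, Submodule.mem_inf, LinearMap.mem_ker]
      constructor
      · rintro ⟨y, hy, rfl⟩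
        exact ⟨hy, rfl⟩
      · rintro ⟨hz, hz0⟩
        have hz1 : incl (Fin.tail z) = z := by
          conv_rhs => rw [← Fin.cons_self_tail z]
          change Fin.cons 0 (Fin.tail z) = Fin.cons (z 0) (Fin.tail z)
          rw [show z 0 = 0 from hz0]
        exact ⟨Fin.tail z, by rw [Submodule.mem_comap, hz1]; exact hz, hz1⟩
    have hV'dim : Module.finrank F V' = Module.finrank F (V ⊓ LinearMap.ker proj : Submodule F _) := by
      rw [← hVmap]
      exact (Submodule.equivMapOfInjective incl hincl V').finrank_eq
    have hV'le : Module.finrank F V' ≤ N := by simpa using Submodule.finrank_le V'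
    have h1a : (0:ℝ) ≤ 1 - a := by linarith
    -- each slice is empty or a coset
    have hslice : ∀ c, mass (iidWeight q N) {z | (Fin.cons c z : Fin (N + 1) → F) - b ∈ V} ≤
        (1 - a) ^ (N - Module.finrank F V') := by
      intro c
      by_cases hne : ∃ z₀ : Fin N → F, (Fin.cons c z₀ : Fin (N + 1) → F) - b ∈ V
      · obtain ⟨z₀, hz₀⟩ := hne
        refine le_trans (mass_mono (isProbWeight_iidWeight hq N) ?_) (ih V' z₀)
        intro z hz
        have : (Fin.cons c z - b : Fin (N + 1) → F) - (Fin.cons c z₀ - b) ∈ V := V.sub_mem hz hz₀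
        change incl (z - z₀) ∈ V
        convert this using 1
        ext i
        refine Fin.cases ?_ (fun i => ?_) i <;> simp [incl]
      · push Not at hne
        have : {z | (Fin.cons c z : Fin (N + 1) → F) - b ∈ V} = ∅ := by
          ext z; simpa using hne z
        rw [this]
        simp only [mass, Set.indicator_empty, Finset.sum_const_zero]
        positivity
    unfold iidWeight
    rw [mass_prefixWeight_cons]
    change ∑ c, q c * mass (iidWeight q N) {z | (Fin.cons c z : Fin (N + 1) → F) - b ∈ V} ≤ _
    -- If the first coordinate vanishes on `V`, it is forced to equal `b 0`, which gains a factor `1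
    -- - a`. Otherwise slicing lowers the dimension by one and the codimension is unchanged, so no
    -- gain is needed.
    by_cases hker : V ≤ LinearMap.ker proj
    · have hdim : Module.finrank F V' = Module.finrank F V := by
        rw [hV'dim, inf_eq_left.2 hker]
      have hother : ∀ c, c ≠ b 0 →
          q c * mass (iidWeight q N) {z | (Fin.cons c z : Fin (N + 1) → F) - b ∈ V} = 0 := by
        intro c hc
        have : {z | (Fin.cons c z : Fin (N + 1) → F) - b ∈ V} = ∅ := by
          ext z
          simp only [Set.mem_ofPred_eq, Set.mem_empty_iff_false, iff_false]
          intro hz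
          have := hker hz
          simp only [proj, LinearMap.mem_ker, LinearMap.proj_apply, Pi.sub_apply, Fin.cons_zero,
            sub_eq_zero] at this
          exact hc this
        rw [this]
        simp [mass]
      rw [Finset.sum_eq_single (b 0) (fun c _ hc => hother c hc) (by simp)]
      rw [hdim] at hslice hV'le
      rw [show N + 1 - Module.finrank F V = N - Module.finrank F V + 1 by omega, pow_succ']
      exact mul_le_mul (hqa _) (hslice _) (mass_nonneg (isProbWeight_iidWeight hq N) _) h1a
    · have hdim : Module.finrank F V = Module.finrank F V' + 1 := by
        let g : V →ₗ[F] F := proj.domRestrict V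
        have hg : LinearMap.range g = ⊤ := by
          rw [LinearMap.range_eq_top]
          refine LinearMap.surjective fun h0 => hker fun v hv => ?_
          have := LinearMap.congr_fun h0 ⟨v, hv⟩
          exact this
        have h1 := LinearMap.finrank_range_add_finrank_ker g
        rw [hg, finrank_top, Module.finrank_self] at h1
        have h2 : Module.finrank F (LinearMap.ker g) = Module.finrank F V' := by
          rw [hV'dim]
          have : (LinearMap.ker g).map V.subtype = V ⊓ LinearMap.ker proj := by
            ext z
            simp [g, and_comm]
          rw [← this, Submodule.finrank_map_subtype_eq]
        omega
      rw [show N + 1 - Module.finrank F V = N - Module.finrank F V' by omega]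
      calc _ ≤ ∑ c, q c * (1 - a) ^ (N - Module.finrank F V') :=
            Finset.sum_le_sum fun c _ => mul_le_mul_of_nonneg_left (hslice c) (hq.nonneg c)
        _ = _ := by rw [← Finset.sum_mul, hq.sum_eq_one, one_mul]

lemma mass_submodule_le (hq : IsProbWeight q) (ha1 : a ≤ 1) (hqa : ∀ r, q r ≤ 1 - a)
    {N : ℕ} (V : Submodule F (Fin N → F)) :
    mass (iidWeight q N) V ≤ (1 - a) ^ (N - Module.finrank F V) := by
  have := mass_coset_le hq ha1 hqa V 0
  simpa using this

end Atoms

/-! ### Characteristic functions, lazy symmetrisation and energy. -/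

section Fourier

variable {p : ℕ} [Fact p.Prime] {q : ZMod p → ℝ} {a : ℝ}

/-- The characteristic function of a weight on `ZMod p`. -/
noncomputable def charFn (q : ZMod p → ℝ) (s : ZMod p) : ℂ := ∑ x, (q x : ℂ) * ZMod.stdAddChar (s * x)

/-- The weight of the difference of two independent variables of weight `q`. -/
def symmWeight (q : ZMod p → ℝ) (d : ZMod p) : ℝ := ∑ b, q b * q (b + d)

/-- The weight of a variable which vanishes with probability `1 - μ`, and otherwise is the
difference of two independent variables of weight `q`. -/
def lazyWeight (q : ZMod p → ℝ) (μ : ℝ) (d : ZMod p) : ℝ :=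
  (1 - μ) * (if d = 0 then 1 else 0) + μ * symmWeight q d

lemma isProbWeight_symmWeight (hq : IsProbWeight q) : IsProbWeight (symmWeight q) where
  nonneg d := Finset.sum_nonneg fun b _ => mul_nonneg (hq.nonneg _) (hq.nonneg _)
  sum_eq_one := by
    unfold symmWeight
    rw [Finset.sum_comm]
    have : ∀ b : ZMod p, ∑ d, q b * q (b + d) = q b := fun b => by
      have h : ∑ d, q (b + d) = 1 := (Equiv.sum_comp (Equiv.addLeft b) q).trans hq.sum_eq_one
      rw [← Finset.mul_sum, h, mul_one]
    simp only [this, hq.sum_eq_one]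

lemma symmWeight_le (hq : IsProbWeight q) (hqa : ∀ r, q r ≤ 1 - a) (d : ZMod p) :
    symmWeight q d ≤ 1 - a := by
  calc symmWeight q d ≤ ∑ b, q b * (1 - a) :=
        Finset.sum_le_sum fun b _ => mul_le_mul_of_nonneg_left (hqa _) (hq.nonneg b)
    _ = 1 - a := by rw [← Finset.sum_mul, hq.sum_eq_one, one_mul]

lemma isProbWeight_lazyWeight (hq : IsProbWeight q) {μ : ℝ} (h0 : 0 ≤ μ) (h1 : μ ≤ 1) :
    IsProbWeight (lazyWeight q μ) where
  nonneg d := add_nonneg (mul_nonneg (by linarith) (by split_ifs <;> norm_num))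
    (mul_nonneg h0 ((isProbWeight_symmWeight hq).nonneg d))
  sum_eq_one := by
    unfold lazyWeight
    rw [Finset.sum_add_distrib, ← Finset.mul_sum, ← Finset.mul_sum,
      (isProbWeight_symmWeight hq).sum_eq_one]
    simp

lemma lazyWeight_le (hq : IsProbWeight q) (hqa : ∀ r, q r ≤ 1 - a) {μ : ℝ} (h0 : 0 ≤ μ)
    (h1 : μ ≤ 1) (d : ZMod p) : lazyWeight q μ d ≤ 1 - μ * a := by
  have := mul_le_mul_of_nonneg_left (symmWeight_le hq hqa d) h0
  unfold lazyWeight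
  split_ifs <;> linarith

lemma charFn_symmWeight (q : ZMod p → ℝ) (s : ZMod p) :
    charFn (symmWeight q) s = ((‖charFn q s‖ ^ 2 : ℝ) : ℂ) := by
  have h1 : ((‖charFn q s‖ ^ 2 : ℝ) : ℂ) = charFn q s * starRingEnd ℂ (charFn q s) := by
    rw [Complex.mul_conj, Complex.normSq_eq_norm_sq]
  rw [h1]
  unfold charFn symmWeight
  rw [map_sum, mul_comm, Finset.sum_mul]
  simp only [Complex.ofReal_sum, Complex.ofReal_mul, Finset.sum_mul]
  rw [Finset.sum_comm]
  refine Finset.sum_congr rfl fun b _ => ?_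
  rw [Finset.mul_sum]
  refine Fintype.sum_equiv (Equiv.addLeft b) _ _ fun d => ?_
  simp only [Equiv.coe_addLeft, map_mul, Complex.conj_ofReal]
  rw [← AddChar.map_neg_eq_conj, mul_add, AddChar.map_add_eq_mul]
  have : ZMod.stdAddChar (-(s * b)) * ZMod.stdAddChar (s * b) = (1 : ℂ) := by
    rw [← AddChar.map_add_eq_mul]; simp
  linear_combination (-(q b : ℂ) * q (b + d) * ZMod.stdAddChar (s * d)) * this

lemma charFn_lazyWeight (q : ZMod p → ℝ) (μ : ℝ) (s : ZMod p) :
    charFn (lazyWeight q μ) s = ((1 - μ * (1 - ‖charFn q s‖ ^ 2) : ℝ) : ℂ) := by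
  have h : charFn (lazyWeight q μ) s = (1 - μ) + μ * charFn (symmWeight q) s := by
    unfold charFn lazyWeight
    simp only [Complex.ofReal_add, Complex.ofReal_mul, add_mul, Finset.sum_add_distrib,
      Finset.mul_sum, mul_assoc]
    congr 1
    rw [Finset.sum_eq_single 0 (fun b _ hb => by simp [hb]) (by simp)]
    simp
  rw [h, charFn_symmWeight]
  push_cast
  ring

lemma norm_charFn_le_one (hq : IsProbWeight q) (s : ZMod p) : ‖charFn q s‖ ≤ 1 := by
  refine (norm_sum_le _ _).trans ?_
  simp only [norm_mul, Complex.norm_real, AddChar.norm_apply, mul_one, Real.norm_eq_abs]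
  simp only [abs_of_nonneg (hq.nonneg _), hq.sum_eq_one, le_refl]

/-- Fourier inversion for the event that a linear form in independent variables vanishes. -/
lemma mass_eq_sum_charFn (q : ZMod p → ℝ) {N : ℕ} (u : Fin N → ZMod p) :
    ((mass (iidWeight q N) {z | u ⬝ᵥ z = 0} : ℝ) : ℂ) = (p : ℂ)⁻¹ * ∑ t, ∏ k, charFn q (t * u k) := by
  classical
  have hp : (p : ℂ) ≠ 0 := Nat.cast_ne_zero.2 (Fact.out : p.Prime).ne_zero
  have h1 : ∀ t, ∏ k, charFn q (t * u k) =
      ∑ z : Fin N → ZMod p, ((iidWeight q N z : ℝ) : ℂ) * ZMod.stdAddChar (t * (u ⬝ᵥ z)) := by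
    intro t
    unfold charFn
    rw [Finset.prod_univ_sum, Fintype.piFinset_univ]
    refine Finset.sum_congr rfl fun z _ => ?_
    rw [Finset.prod_mul_distrib]
    simp only [iidWeight, prefixWeight, tupleWeight, Complex.ofReal_prod, dotProduct, Finset.mul_sum,
      mul_assoc]
    congr 1
    exact (map_prod ZMod.stdAddChar.toMonoidHom
      (fun k => Multiplicative.ofAdd (t * (u k * z k))) Finset.univ).symm
  simp only [h1]
  rw [Finset.sum_comm]
  simp only [← Finset.mul_sum, AddChar.sum_mulShift _ (ZMod.isPrimitive_stdAddChar p), ZMod.card]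
  rw [Finset.mul_sum, mass, Complex.ofReal_sum]
  refine Finset.sum_congr rfl fun z _ => ?_
  by_cases hz : u ⬝ᵥ z = 0
  · simp [hz]
    field_simp
  · simp [hz]

/-- The energy `∑ k, (1 - |φ(t u_k)|²)`, where `φ` is the characteristic function of `q`. -/
noncomputable def energy (q : ZMod p → ℝ) {N : ℕ} (u : Fin N → ZMod p) (t : ZMod p) : ℝ :=
  ∑ k, (1 - ‖charFn q (t * u k)‖ ^ 2)

lemma one_sub_norm_charFn_sq (hq : IsProbWeight q) (s : ZMod p) :
    1 - ‖charFn q s‖ ^ 2 =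
      ∑ d, symmWeight q d * (‖1 - (ZMod.stdAddChar (s * d) : ℂ)‖ ^ 2 / 2) := by
  have h1 := congrArg Complex.re (charFn_symmWeight q s)
  rw [Complex.ofReal_re] at h1
  rw [← h1, ← (isProbWeight_symmWeight hq).sum_eq_one]
  unfold charFn
  rw [Complex.re_sum, ← Finset.sum_sub_distrib]
  refine Finset.sum_congr rfl fun d _ => ?_
  have h2 : ‖1 - (ZMod.stdAddChar (s * d) : ℂ)‖ ^ 2 = 2 - 2 * (ZMod.stdAddChar (s * d) : ℂ).re := by
    have h3 : ‖(ZMod.stdAddChar (s * d) : ℂ)‖ ^ 2 = 1 := by rw [AddChar.norm_apply]; norm_num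
    rw [← Complex.normSq_eq_norm_sq, Complex.normSq_apply] at h3 ⊢
    simp only [Complex.sub_re, Complex.one_re, Complex.sub_im, Complex.one_im]
    linarith
  rw [h2, Complex.re_ofReal_mul]
  ring

lemma energy_nonneg (hq : IsProbWeight q) {N : ℕ} (u : Fin N → ZMod p) (t : ZMod p) :
    0 ≤ energy q u t :=
  Finset.sum_nonneg fun k _ => by
    have := norm_charFn_le_one hq (t * u k)
    nlinarith [norm_nonneg (charFn q (t * u k))]

lemma energy_zero (hq : IsProbWeight q) {N : ℕ} (u : Fin N → ZMod p) : energy q u 0 = 0 := by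
  unfold energy
  simp [one_sub_norm_charFn_sq hq]

/-- By `one_sub_norm_charFn_sq`, the energy is an average of squared distances `‖1 - e(·)‖²`, and
these distances obey the triangle inequality on the unit circle. Squaring costs the factor 2. -/
lemma energy_add_le (hq : IsProbWeight q) {N : ℕ} (u : Fin N → ZMod p) (t t' : ZMod p) :
    energy q u (t + t') ≤ 2 * energy q u t + 2 * energy q u t' := by
  unfold energy
  simp only [one_sub_norm_charFn_sq hq, Finset.mul_sum, ← Finset.sum_add_distrib]
  refine Finset.sum_le_sum fun k _ => Finset.sum_le_sum fun d _ => ?_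
  have h1 : ‖1 - (ZMod.stdAddChar ((t + t') * u k * d) : ℂ)‖ ≤
      ‖1 - (ZMod.stdAddChar (t * u k * d) : ℂ)‖ + ‖1 - (ZMod.stdAddChar (t' * u k * d) : ℂ)‖ := by
    rw [add_mul, add_mul, AddChar.map_add_eq_mul]
    set x : ℂ := ZMod.stdAddChar (t * u k * d) with hx
    set y : ℂ := ZMod.stdAddChar (t' * u k * d)
    have hx1 : ‖x‖ = 1 := by rw [hx, AddChar.norm_apply]
    calc ‖1 - x * y‖ = ‖(1 - x) + x * (1 - y)‖ := by congr 1; ring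
      _ ≤ ‖1 - x‖ + ‖x * (1 - y)‖ := norm_add_le _ _
      _ = _ := by rw [norm_mul, hx1, one_mul]
  have h2 : ‖1 - (ZMod.stdAddChar ((t + t') * u k * d) : ℂ)‖ ^ 2 ≤
      2 * ‖1 - (ZMod.stdAddChar (t * u k * d) : ℂ)‖ ^ 2 +
        2 * ‖1 - (ZMod.stdAddChar (t' * u k * d) : ℂ)‖ ^ 2 := by
    refine (pow_le_pow_left₀ (norm_nonneg _) h1 2).trans ?_
    nlinarith [sq_nonneg (‖1 - (ZMod.stdAddChar (t * u k * d) : ℂ)‖ -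
      ‖1 - (ZMod.stdAddChar (t' * u k * d) : ℂ)‖)]
  have := mul_le_mul_of_nonneg_left h2 ((isProbWeight_symmWeight hq).nonneg d)
  linarith

/-- By orthogonality of characters, for `v ≠ 0` the average of `‖charFn q (t * v)‖²` over `t` is the
collision probability `symmWeight q 0`, at most `1 - a`. Hence low energy levels cannot fill `ZMod
p`. -/
lemma le_sum_energy (hq : IsProbWeight q) (hqa : ∀ r, q r ≤ 1 - a) {N : ℕ} (u : Fin N → ZMod p) :
    p * (a * (Finset.univ.filter fun k => u k ≠ 0).card) ≤ ∑ t, energy q u t := by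
  classical
  have hsum : ∀ v : ZMod p, v ≠ 0 → p * a ≤ ∑ t, (1 - ‖charFn q (t * v)‖ ^ 2) := by
    intro v hv
    have h1 : ∀ t : ZMod p, ‖charFn q (t * v)‖ ^ 2 =
        ∑ d, symmWeight q d * (ZMod.stdAddChar (t * (v * d)) : ℂ).re := by
      intro t
      have h := congrArg Complex.re (charFn_symmWeight q (t * v))
      rw [Complex.ofReal_re] at h
      rw [← h, charFn, Complex.re_sum]
      exact Finset.sum_congr rfl fun d _ => by rw [Complex.re_ofReal_mul, mul_assoc]
    have h2 : ∑ t : ZMod p, ‖charFn q (t * v)‖ ^ 2 = p * symmWeight q 0 := by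
      simp only [h1]
      rw [Finset.sum_comm]
      simp only [← Finset.mul_sum, ← Complex.re_sum,
        AddChar.sum_mulShift _ (ZMod.isPrimitive_stdAddChar p), ZMod.card]
      rw [Finset.sum_eq_single 0 (fun d _ hd => by simp [hv, hd]) (by simp)]
      simp [mul_comm]
    rw [Finset.sum_sub_distrib, h2]
    simp only [Finset.sum_const, Finset.card_univ, ZMod.card, nsmul_eq_mul, mul_one]
    have := mul_le_mul_of_nonneg_left (symmWeight_le hq hqa 0) (Nat.cast_nonneg (α := ℝ) p)
    linarith
  unfold energy
  rw [Finset.sum_comm]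
  calc (p : ℝ) * (a * (Finset.univ.filter fun k => u k ≠ 0).card)
      = ∑ k ∈ Finset.univ.filter fun k => u k ≠ 0, p * a := by
        rw [Finset.sum_const, nsmul_eq_mul]; ring
    _ ≤ ∑ k ∈ Finset.univ.filter fun k => u k ≠ 0, ∑ t, (1 - ‖charFn q (t * u k)‖ ^ 2) :=
        Finset.sum_le_sum fun k hk => hsum _ (Finset.mem_filter.1 hk).2
    _ ≤ _ := by
        refine Finset.sum_le_sum_of_subset_of_nonneg (Finset.filter_subset _ _) fun k _ _ => ?_
        refine Finset.sum_nonneg fun t _ => ?_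
        have := norm_charFn_le_one hq (t * u k)
        nlinarith [norm_nonneg (charFn q (t * u k))]

end Fourier

/-! ### The Halász-type comparison with lazy variables. -/

section Halasz

/-- If `g'` has at least `m` times as many small values as `g`, then the sum of an antitone
function over the values of `g'` is at least `m` times that over the values of `g`. -/
lemma mul_sum_le_sum_of_card_le {α β : Type*} [DecidableEq α] [DecidableEq β] (m : ℕ)
    (g : α → ℝ) (g' : β → ℝ) (f : ℝ → ℝ) (hf : Antitone f) (hf0 : ∀ x, 0 ≤ f x)
    (T : Finset α) (S : Finset β)
    (h : ∀ t ∈ T, m * (T.filter fun t' => g t' ≤ g t).card ≤ (S.filter fun s => g' s ≤ g t).card) :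
    m * ∑ t ∈ T, f (g t) ≤ ∑ s ∈ S, f (g' s) := by
  -- Elements of `T` are treated in increasing order of `g`, each claiming `m` fresh elements of `S`
  -- with no larger value. Keeping the cardinality of `S'` exact guarantees that `m` unclaimed ones
  -- remain.
  suffices H : ∃ S' ⊆ S, S'.card = m * T.card ∧ m * ∑ t ∈ T, f (g t) ≤ ∑ s ∈ S', f (g' s) by
    obtain ⟨S', hS', -, hle⟩ := H
    exact hle.trans (Finset.sum_le_sum_of_subset_of_nonneg hS' fun _ _ _ => hf0 _)
  induction T using Finset.induction_on_max_value g with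
  | empty => exact ⟨∅, by simp, by simp, by simp⟩
  | insert a T ha hmax ih =>
    obtain ⟨S', hS', hcard, hle⟩ := ih fun t ht => le_trans
      (Nat.mul_le_mul_left m (Finset.card_le_card (Finset.filter_subset_filter _
        (Finset.subset_insert a T)))) (h t (Finset.mem_insert_of_mem ht))
    have h1 := h a (Finset.mem_insert_self a T)
    rw [Finset.filter_true_of_mem (by
      intro x hx
      rcases Finset.mem_insert.1 hx with rfl | hx
      · exact le_rfl
      · exact hmax x hx), Finset.card_insert_of_notMem ha] at h1
    have h2 : m ≤ ((S.filter fun s => g' s ≤ g a) \ S').card := by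
      have := Finset.le_card_sdiff S' (S.filter fun s => g' s ≤ g a)
      rw [hcard] at this
      have h3 : m * (T.card + 1) = m * T.card + m := by ring
      omega
    obtain ⟨R, hR, hRcard⟩ := Finset.exists_subset_card_eq h2
    have hdisj : Disjoint S' R := by
      rw [Finset.disjoint_left]
      intro x hx hxR
      exact (Finset.mem_sdiff.1 (hR hxR)).2 hx
    refine ⟨S' ∪ R, Finset.union_subset hS' fun x hx =>
      (Finset.mem_filter.1 (Finset.mem_sdiff.1 (hR hx)).1).1, ?_, ?_⟩
    · rw [Finset.card_union_of_disjoint hdisj, hcard, hRcard, Finset.card_insert_of_notMem ha]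
      ring
    · rw [Finset.sum_union hdisj, Finset.sum_insert ha]
      have h3 : (m : ℝ) * f (g a) ≤ ∑ s ∈ R, f (g' s) := by
        rw [← hRcard, ← nsmul_eq_mul]
        refine Finset.card_nsmul_le_sum _ _ _ fun x hx => hf ?_
        exact (Finset.mem_filter.1 (Finset.mem_sdiff.1 (hR hx)).1).2
      linarith

variable {p : ℕ} [Fact p.Prime] {q : ZMod p → ℝ} {a : ℝ}

-- The sumset of the level set `T` at height `x` lies in the level set at height `4 * x`, and
-- Cauchy–Davenport gives it at least `2|T| - 1` elements unless it is everything, which `hnf`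
-- forbids. Discarding `t = 0` turns this into an exact doubling.
open scoped Pointwise in
lemma two_mul_card_energy_le (hq : IsProbWeight q) {N : ℕ} (u : Fin N → ZMod p) {x : ℝ}
    (hx : 0 ≤ x) (hnf : ∃ t, 4 * x < energy q u t) :
    2 * (Finset.univ.filter fun t => t ≠ 0 ∧ energy q u t ≤ x).card ≤
      (Finset.univ.filter fun t => t ≠ 0 ∧ energy q u t ≤ 4 * x).card := by
  classical
  have hp : p.Prime := Fact.out
  have hcard : ∀ y, 0 ≤ y → (Finset.univ.filter fun t => energy q u t ≤ y).card =
      (Finset.univ.filter fun t => t ≠ 0 ∧ energy q u t ≤ y).card + 1 := by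
    intro y hy
    have h0 : (0 : ZMod p) ∈ Finset.univ.filter fun t => energy q u t ≤ y := by
      simp [energy_zero hq, hy]
    rw [← Finset.card_erase_add_one h0]
    congr 2
    ext t
    simp
  set T := Finset.univ.filter fun t => energy q u t ≤ x with hT
  have hne : T.Nonempty := ⟨0, by simp [hT, energy_zero hq, hx]⟩
  have hcd := ZMod.cauchy_davenport hp hne hne
  have hsub : T + T ⊆ Finset.univ.filter fun t => energy q u t ≤ 4 * x := by
    intro t ht
    obtain ⟨t₁, h₁, t₂, h₂, rfl⟩ := Finset.mem_add.1 ht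
    simp only [hT, Finset.mem_filter, Finset.mem_univ, true_and] at h₁ h₂ ⊢
    linarith [energy_add_le hq u t₁ t₂]
  have hlt : (Finset.univ.filter fun t => energy q u t ≤ 4 * x).card < p := by
    obtain ⟨t, ht⟩ := hnf
    have : (Finset.univ.filter fun t => energy q u t ≤ 4 * x) ⊂ Finset.univ := by
      rw [Finset.ssubset_univ_iff, Ne, Finset.filter_eq_self]
      intro h
      exact (not_le.2 ht) (by simpa using h t)
    simpa [ZMod.card] using Finset.card_lt_card this
  have h3 := hcd.trans (Finset.card_le_card hsub)
  rw [hcard (4 * x) (by linarith)] at h3 hlt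
  rw [hT, hcard x hx] at h3
  omega

lemma two_pow_mul_card_energy_le (hq : IsProbWeight q) {N : ℕ} (u : Fin N → ZMod p) {x : ℝ}
    (hx : 0 ≤ x) (i : ℕ) (hnf : ∃ t, 4 ^ i * x < energy q u t) :
    2 ^ i * (Finset.univ.filter fun t => t ≠ 0 ∧ energy q u t ≤ x).card ≤
      (Finset.univ.filter fun t => t ≠ 0 ∧ energy q u t ≤ 4 ^ i * x).card := by
  induction i with
  | zero => simp
  | succ i ih =>
    have hx' : 0 ≤ 4 ^ i * x := by positivity
    have h1 := two_mul_card_energy_le hq u hx' (by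
      obtain ⟨t, ht⟩ := hnf
      exact ⟨t, by rw [pow_succ'] at ht; linarith⟩)
    have h2 := ih (by
      obtain ⟨t, ht⟩ := hnf
      exact ⟨t, by rw [pow_succ'] at ht; linarith⟩)
    rw [show (4:ℝ) ^ (i + 1) * x = 4 * (4 ^ i * x) by ring, pow_succ']
    linarith

lemma exp_neg_two_mul_le {x : ℝ} (h0 : 0 ≤ x) (h1 : x ≤ 1 / 2) : Real.exp (-(2 * x)) ≤ 1 - x := by
  rw [Real.exp_neg, inv_le_comm₀ (Real.exp_pos _) (by linarith)]
  refine le_trans ?_ (Real.add_one_le_exp _)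
  rw [inv_le_iff_one_le_mul₀ (by linarith)]
  nlinarith

lemma le_exp_of_sq_le {x y : ℝ} (h : x ^ 2 ≤ 1 - y) : x ≤ Real.exp (-y / 2) := by
  refine le_of_sq_le_sq ?_ (Real.exp_pos _).le
  rw [← Real.exp_nat_mul]
  have := Real.add_one_le_exp (-y)
  calc x ^ 2 ≤ 1 - y := h
    _ ≤ Real.exp (-y) := by linarith
    _ = _ := by congr 1; push_cast; ring

/-- Comparison of the concentration of a linear form in independent variables with that of the same
linear form in the corresponding lazy variables. -/
theorem mass_le_mass_lazy (hq : IsProbWeight q) (ha : 0 ≤ a) (hqa : ∀ r, q r ≤ 1 - a) (i : ℕ) {N : ℕ}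
    (u : Fin N → ZMod p) {s : ℕ} (hs : s ≤ (Finset.univ.filter fun k => u k ≠ 0).card) :
    mass (iidWeight q N) {z | u ⬝ᵥ z = 0} ≤ 1 / p + Real.exp (-(a * s / 4 ^ i / 2)) +
      1 / 2 ^ i * mass (iidWeight (lazyWeight q (1 / 4 ^ (i + 1))) N) {z | u ⬝ᵥ z = 0} := by
  classical
  have hp : 0 < (p : ℝ) := Nat.cast_pos.2 (Fact.out : p.Prime).pos
  set μ : ℝ := 1 / 4 ^ (i + 1) with hμ
  have h4 : (0:ℝ) < 4 ^ i := by positivity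
  have h41 : (1:ℝ) ≤ 4 ^ i := one_le_pow₀ (by norm_num)
  have hμ0 : 0 ≤ μ := by positivity
  have hμ2 : μ ≤ 1 / 2 := by
    rw [hμ, pow_succ]
    rw [div_le_div_iff₀ (by positivity) (by norm_num)]
    linarith
  have hη : ∀ s, 0 ≤ 1 - ‖charFn q s‖ ^ 2 ∧ 1 - ‖charFn q s‖ ^ 2 ≤ 1 := fun s => by
    have := norm_charFn_le_one hq s
    constructor <;> nlinarith [norm_nonneg (charFn q s)]
  -- upper bound for the original variables
  have hup : mass (iidWeight q N) {z | u ⬝ᵥ z = 0} ≤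
      (p : ℝ)⁻¹ * ∑ t, Real.exp (-(energy q u t) / 2) := by
    have h1 := congrArg norm (mass_eq_sum_charFn q u)
    rw [Complex.norm_real, Real.norm_of_nonneg (mass_nonneg (isProbWeight_iidWeight hq N) _),
      norm_mul, norm_inv, Complex.norm_natCast] at h1
    rw [h1]
    refine mul_le_mul_of_nonneg_left ((norm_sum_le _ _).trans (Finset.sum_le_sum fun t _ => ?_))
      (by positivity)
    rw [norm_prod, energy, ← Finset.sum_neg_distrib, Finset.sum_div, Real.exp_sum]
    refine Finset.prod_le_prod (fun k _ => norm_nonneg _) fun k _ => le_exp_of_sq_le (by linarith)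
  -- lower bound for the lazy variables
  have hlow : (p : ℝ)⁻¹ * ∑ t, Real.exp (-(energy q u t / 4 ^ i) / 2) ≤
      mass (iidWeight (lazyWeight q μ) N) {z | u ⬝ᵥ z = 0} := by
    have h1 := congrArg Complex.re (mass_eq_sum_charFn (lazyWeight q μ) u)
    simp only [charFn_lazyWeight] at h1
    rw [Complex.ofReal_re] at h1
    have h2 : (p : ℂ)⁻¹ * ∑ t, ∏ k, ((1 - μ * (1 - ‖charFn q (t * u k)‖ ^ 2) : ℝ) : ℂ) =
        (((p : ℝ)⁻¹ * ∑ t, ∏ k, (1 - μ * (1 - ‖charFn q (t * u k)‖ ^ 2)) : ℝ) : ℂ) := by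
      push_cast; rfl
    rw [h1, h2, Complex.ofReal_re]
    refine mul_le_mul_of_nonneg_left (Finset.sum_le_sum fun t _ => ?_) (by positivity)
    rw [energy, Finset.sum_div, ← Finset.sum_neg_distrib, Finset.sum_div, Real.exp_sum]
    refine Finset.prod_le_prod (fun k _ => (Real.exp_pos _).le) fun k _ => ?_
    obtain ⟨e0, e1⟩ := hη (t * u k)
    refine le_trans (le_of_eq ?_) (exp_neg_two_mul_le (mul_nonneg hμ0 e0) (by nlinarith))
    congr 1
    rw [hμ, pow_succ]
    field_simp
    ring
  -- comparison
  set A : ℝ := a * s / 4 ^ i with hA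
  set T := Finset.univ.filter fun t => t ≠ 0 ∧ energy q u t < A with hT
  set S : Finset (ZMod p) := Finset.univ.filter fun t => t ≠ 0 with hS
  have hcmp : ((2 ^ i : ℕ) : ℝ) * ∑ t ∈ T, Real.exp (-(energy q u t) / 2) ≤
      ∑ t ∈ S, Real.exp (-(energy q u t / 4 ^ i) / 2) := by
    refine mul_sum_le_sum_of_card_le (2 ^ i) (energy q u) (fun t => energy q u t / 4 ^ i)
      (fun x => Real.exp (-x / 2)) (fun x y hxy => Real.exp_le_exp.2 (by linarith))
      (fun x => (Real.exp_pos _).le) T S fun t ht => ?_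
    simp only [hT, Finset.mem_filter, Finset.mem_univ, true_and] at ht
    have hx0 := energy_nonneg hq u t
    have hnf : ∃ t', 4 ^ i * energy q u t < energy q u t' := by
      by_contra hcon
      push Not at hcon
      have h1 := le_sum_energy hq hqa u
      have h2 : ∑ t', energy q u t' ≤ p * (4 ^ i * energy q u t) := by
        refine (Finset.sum_le_sum fun t' _ => hcon t').trans ?_
        simp [ZMod.card]
      have h3 : (4:ℝ) ^ i * energy q u t < a * s := by
        have := ht.2
        rw [hA, lt_div_iff₀ h4] at this
        linarith
      have h4 : a * s ≤ a * (Finset.univ.filter fun k => u k ≠ 0).card :=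
        mul_le_mul_of_nonneg_left (Nat.cast_le.2 hs) ha
      have h5 := mul_lt_mul_of_pos_left (h3.trans_le h4) hp
      linarith
    refine le_trans (Nat.mul_le_mul_left _ (Finset.card_le_card ?_))
      ((two_pow_mul_card_energy_le hq u hx0 i hnf).trans (Finset.card_le_card ?_))
    · intro t' ht'
      simp only [hT, Finset.mem_filter, Finset.mem_univ, true_and] at ht' ⊢
      exact ⟨ht'.1.1, ht'.2⟩
    · intro t' ht'
      simp only [hS, Finset.mem_filter, Finset.mem_univ, true_and] at ht' ⊢
      exact ⟨ht'.1, by rw [div_le_iff₀ h4]; linarith [ht'.2]⟩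
  have hsplit : ∑ t, Real.exp (-(energy q u t) / 2) ≤
      1 + p * Real.exp (-(A / 2)) + ∑ t ∈ T, Real.exp (-(energy q u t) / 2) := by
    have h1 : ∀ t, Real.exp (-(energy q u t) / 2) ≤ (if t = 0 then 1 else 0) + Real.exp (-(A / 2)) +
        (if t ≠ 0 ∧ energy q u t < A then Real.exp (-(energy q u t) / 2) else 0) := by
      intro t
      have e0 := Real.exp_pos (-(A / 2))
      by_cases ht : t = 0
      · simp [ht, energy_zero hq, e0.le]
      · by_cases ht2 : energy q u t < A
        · simp [ht, ht2, e0.le]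
        · simp only [ht, ht2, if_false, and_false, zero_add, add_zero]
          exact Real.exp_le_exp.2 (by linarith)
    refine (Finset.sum_le_sum fun t _ => h1 t).trans (le_of_eq ?_)
    rw [Finset.sum_add_distrib, Finset.sum_add_distrib, hT, Finset.sum_filter]
    simp [ZMod.card]
  have hSle : ∑ t ∈ S, Real.exp (-(energy q u t / 4 ^ i) / 2) ≤
      ∑ t, Real.exp (-(energy q u t / 4 ^ i) / 2) :=
    Finset.sum_le_sum_of_subset_of_nonneg (Finset.filter_subset _ _) fun _ _ _ => (Real.exp_pos _).le
  have h2i : (0:ℝ) < 2 ^ i := by positivity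
  have hTle : ∑ t ∈ T, Real.exp (-(energy q u t) / 2) ≤
      1 / 2 ^ i * ∑ t, Real.exp (-(energy q u t / 4 ^ i) / 2) := by
    rw [one_div, ← div_eq_inv_mul, le_div_iff₀ h2i]
    push_cast at hcmp
    linarith
  calc mass (iidWeight q N) {z | u ⬝ᵥ z = 0}
      ≤ (p : ℝ)⁻¹ * (1 + p * Real.exp (-(A / 2)) +
          1 / 2 ^ i * ∑ t, Real.exp (-(energy q u t / 4 ^ i) / 2)) :=
        hup.trans (mul_le_mul_of_nonneg_left (hsplit.trans (by linarith)) (by positivity))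
    _ = 1 / p + Real.exp (-(A / 2)) +
          1 / 2 ^ i * ((p : ℝ)⁻¹ * ∑ t, Real.exp (-(energy q u t / 4 ^ i) / 2)) := by
        field_simp
    _ ≤ _ := by
        have := mul_le_mul_of_nonneg_left hlow (show (0:ℝ) ≤ 1 / 2 ^ i by positivity)
        linarith

end Halasz

/-! ### The Kahn–Komlós–Szemerédi swapping argument. -/

section Swap

variable {F E : Type*} [Field F] [AddCommGroup E] [Module F E]

/-- Steinitz exchange: independent vectors of `V` replace some members of a basis of `V`. -/
lemma exists_exchange {ι : Type*} [Fintype ι] [DecidableEq ι] {m : ℕ} {V : Submodule F E} {y : Fin m → E}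
    (hy : LinearIndependent F y) (hyV : ∀ i, y i ∈ V) {x : ι → E}
    (hx : Submodule.span F (Set.range x) = V) (hV : Module.finrank F V = Fintype.card ι) :
    ∃ I ∈ Finset.powersetCard (Fintype.card ι - m) (Finset.univ : Finset ι),
      Submodule.span F (Set.range y ∪ x '' I) = V := by
  classical
  let v : Fin m ⊕ ι → E := Sum.elim y x
  have hs : LinearIndepOn F v (Set.range Sum.inl) := by
    rw [linearIndepOn_range_iff Sum.inl_injective]
    exact hy
  obtain ⟨b, -, hsb, hspan, hli⟩ := exists_linearIndepOn_extension hs (Set.subset_univ _)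
  have hmem : ∀ z, v z ∈ V := by
    rintro (i | i)
    · exact hyV i
    · rw [← hx]; exact Submodule.subset_span ⟨i, rfl⟩
  have hb : Submodule.span F (v '' b) = V := by
    refine le_antisymm (Submodule.span_le.2 ?_) ?_
    · rintro _ ⟨z, -, rfl⟩
      exact hmem z
    · rw [← hx, Submodule.span_le]
      rintro _ ⟨i, rfl⟩
      exact hspan ⟨Sum.inr i, Set.mem_univ _, rfl⟩
  have hcard : Fintype.card b = Fintype.card ι := by
    have h := finrank_span_eq_card (R := F) (b := fun z : b => v z) hli
    rw [← Set.image_eq_range, hb, hV] at h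
    exact h.symm
  let I : Finset ι := Finset.univ.filter fun i => Sum.inr i ∈ b
  have hcardb : Fintype.card b = m + I.card := by
    rw [Fintype.card_subtype, Finset.card_filter, Fintype.sum_sum_type, Finset.card_filter]
    congr 1
    rw [Finset.sum_congr rfl fun i _ => if_pos (hsb ⟨i, rfl⟩)]
    simp
  refine ⟨I, Finset.mem_powersetCard.2 ⟨Finset.subset_univ _, by omega⟩, ?_⟩
  rw [← hb]
  congr 1
  ext e
  constructor
  · rintro (⟨i, rfl⟩ | ⟨i, hi, rfl⟩)
    · exact ⟨Sum.inl i, hsb ⟨i, rfl⟩, rfl⟩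
    · exact ⟨Sum.inr i, (Finset.mem_filter.1 hi).2, rfl⟩
  · rintro ⟨i | i, hi, rfl⟩
    · exact Or.inl ⟨i, rfl⟩
    · exact Or.inr ⟨i, by simpa [I] using hi, rfl⟩

variable [Fintype E]

/-- Choose the vectors greedily: those already chosen span a space `U` of dimension less than `m`,
and the next must fall in `V` but outside `U`. -/
lemma pow_le_mass_linearIndependent {η : E → ℝ} (hη : IsProbWeight η) (V : Submodule F E) {m : ℕ}
    {δ : ℝ} (hδ : 0 ≤ δ)
    (h : ∀ U : Submodule F E, Module.finrank F U < m → δ ≤ mass η V - mass η U) :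
    δ ^ m ≤ mass (prefixWeight (fun _ => η) m) {y | LinearIndependent F y ∧ ∀ i, y i ∈ V} := by
  suffices H : ∀ k ≤ m, δ ^ k ≤
      mass (prefixWeight (fun _ => η) k) {y | LinearIndependent F y ∧ ∀ i, y i ∈ V} from H m le_rfl
  intro k
  induction k with
  | zero =>
    intro _
    have : {y : Fin 0 → E | LinearIndependent F y ∧ ∀ i, y i ∈ V} = Set.univ := by
      ext y
      simp
    rw [this, mass_univ (isProbWeight_prefixWeight fun _ _ => hη), pow_zero]
  | succ k ih =>
    intro hk
    rw [mass_prefixWeight_snoc, pow_succ]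
    refine (mul_le_mul_of_nonneg_right (ih (by omega)) hδ).trans ?_
    rw [mass, Finset.sum_mul]
    refine Finset.sum_le_sum fun x _ => ?_
    have hw := (isProbWeight_prefixWeight (w := fun _ => η) (k := k) fun _ _ => hη).nonneg x
    by_cases hx : x ∈ {y : Fin k → E | LinearIndependent F y ∧ ∀ i, y i ∈ V}
    · rw [Set.indicator_of_mem hx]
      refine mul_le_mul_of_nonneg_left ?_ hw
      have h1 := h (Submodule.span F (Set.range x)) (by
        rw [finrank_span_eq_card hx.1, Fintype.card_fin]; omega)
      have h2 := mass_le_add_diff hη (V : Set E) (Submodule.span F (Set.range x))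
      refine le_trans (by linarith) (mass_mono hη ?_ (A := (V : Set E) \ Submodule.span F (Set.range x)))
      rintro c ⟨hcV, hc⟩
      refine ⟨linearIndependent_finSnoc.2 ⟨hx.1, hc⟩, fun i => ?_⟩
      refine Fin.lastCases ?_ (fun i => ?_) i
      · simpa using hcV
      · simpa using hx.2 i
    · rw [Set.indicator_of_notMem hx, zero_mul]
      exact mul_nonneg hw (mass_nonneg hη _)

/-- The swapping argument of Kahn, Komlós and Szemerédi: independent random vectors are unlikely to
span a subspace in which other random vectors are much more concentrated. -/
theorem mass_span_mem_le {ι : Type*} [Fintype ι] [DecidableEq ι] {w : ι → E → ℝ}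
    (hw : ∀ i, IsProbWeight (w i)) {η : E → ℝ} (hη : IsProbWeight η) {m : ℕ}
    (hm : m ≤ Fintype.card ι) {C : ℝ} (hC : 0 < C) (𝒱 : Set (Submodule F E))
    (hdim : ∀ V ∈ 𝒱, Module.finrank F V = Fintype.card ι) (r : Submodule F E → ℝ)
    (hr : ∀ V ∈ 𝒱, 0 < r V) (hX : ∀ V ∈ 𝒱, ∀ i, mass (w i) V ≤ r V)
    (hY : ∀ V ∈ 𝒱, ∀ U : Submodule F E, Module.finrank F U < m → C * r V ≤ mass η V - mass η U) :
    mass (tupleWeight w) {x | Submodule.span F (Set.range x) ∈ 𝒱} ≤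
      (Fintype.card ι).choose m / C ^ m := by
  classical
  have hfin : Finite (Submodule F E) := Finite.of_injective _ SetLike.coe_injective
  set S : Finset (Submodule F E) := (Set.toFinite 𝒱).toFinset with hS
  have hSmem : ∀ V, V ∈ S ↔ V ∈ 𝒱 := fun V => Set.Finite.mem_toFinset _
  set ω := prefixWeight (fun _ => η) m
  have hω : IsProbWeight ω := isProbWeight_prefixWeight fun _ _ => hη
  have hW := isProbWeight_tupleWeight hw
  set 𝓘 := Finset.powersetCard (Fintype.card ι - m) (Finset.univ : Finset ι) with h𝓘
  set G : Submodule F E → Finset ι → (Fin m → E) → ℝ := fun V I y =>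
    mass (tupleWeight w) {x | Submodule.span F (Set.range y ∪ x '' I) = V} with hG
  have hG0 : ∀ V I y, 0 ≤ G V I y := fun V I y => mass_nonneg hW _
  -- With `y` drawn independently of `x`, multiply the probability that `x` spans `V` by the
  -- probability that `y` is independent in `V`. After exchange, `y` and `x '' I` span `V`, while
  -- the `m` remaining `x i` independently fall in `V`, at cost at most `r V ^ m`. The powers of `r
  -- V` cancel, leaving `C ^ m`.
  have hone : ∀ V ∈ S, mass (tupleWeight w) {x | Submodule.span F (Set.range x) = V} * C ^ m ≤
      ∑ I ∈ 𝓘, ∑ y, ω y * G V I y := by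
    intro V hVS
    have hV := (hSmem V).1 hVS
    set B : Set (Fin m → E) := {y | LinearIndependent F y ∧ ∀ i, y i ∈ V}
    have hB : (C * r V) ^ m ≤ mass ω B :=
      pow_le_mass_linearIndependent hη V (mul_nonneg hC.le (hr V hV).le) (hY V hV)
    have hy : ∀ y ∈ B, mass (tupleWeight w) {x | Submodule.span F (Set.range x) = V} ≤
        ∑ I ∈ 𝓘, G V I y * r V ^ m := by
      intro y hyB
      refine (mass_le_sum hW 𝓘 _ (fun I => {x | Submodule.span F (Set.range y ∪ x '' I) = V} ∩
        {x | ∀ i, i ∉ I → x i ∈ (V : Set E)}) ?_).trans (Finset.sum_le_sum fun I hI => ?_)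
      · intro x hx
        obtain ⟨I, hI, hspan⟩ := exists_exchange hyB.1 hyB.2 hx (hdim V hV)
        refine ⟨I, hI, hspan, fun i _ => ?_⟩
        have hx' : Submodule.span F (Set.range x) = V := hx
        rw [← hx']
        exact Submodule.subset_span ⟨i, rfl⟩
      · have hIc : Iᶜ.card = m := by
          rw [Finset.card_compl, (Finset.mem_powersetCard.1 hI).2]
          omega
        rw [mass_inter_pi hw I _ (fun x x' hxx => by
          have : x '' I = x' '' I := Set.image_congr fun i hi => hxx i hi
          simp only [Set.mem_ofPred_eq, this])]
        refine mul_le_mul_of_nonneg_left ?_ (hG0 V I y)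
        rw [← hIc, ← Finset.prod_const]
        exact Finset.prod_le_prod (fun i _ => mass_nonneg (hw i) _) fun i _ => hX V hV i
    have h1 : mass (tupleWeight w) {x | Submodule.span F (Set.range x) = V} * (C * r V) ^ m ≤
        ∑ y, ω y * ∑ I ∈ 𝓘, G V I y * r V ^ m := by
      refine (mul_le_mul_of_nonneg_left hB (mass_nonneg hW _)).trans ?_
      rw [mass.eq_def ω, Finset.mul_sum]
      refine Finset.sum_le_sum fun y _ => ?_
      by_cases hyB : y ∈ B
      · rw [Set.indicator_of_mem hyB, mul_comm]
        exact mul_le_mul_of_nonneg_left (hy y hyB) (hω.nonneg y)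
      · rw [Set.indicator_of_notMem hyB, mul_zero]
        exact mul_nonneg (hω.nonneg y) (Finset.sum_nonneg fun I _ =>
          mul_nonneg (hG0 V I y) (pow_nonneg (hr V hV).le _))
    have h2 : ∑ y, ω y * ∑ I ∈ 𝓘, G V I y * r V ^ m = (∑ I ∈ 𝓘, ∑ y, ω y * G V I y) * r V ^ m := by
      rw [Finset.sum_comm, Finset.sum_mul]
      refine Finset.sum_congr rfl fun y _ => ?_
      rw [Finset.mul_sum, Finset.sum_mul]
      exact Finset.sum_congr rfl fun I _ => by ring
    rw [h2, mul_pow, ← mul_assoc] at h1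
    exact le_of_mul_le_mul_right h1 (pow_pos (hr V hV) m)
  rw [le_div_iff₀ (pow_pos hC m)]
  have hset : {x : ι → E | Submodule.span F (Set.range x) ∈ 𝒱} =
      {x | Submodule.span F (Set.range x) ∈ S} := by
    ext x; simp [hSmem]
  rw [hset, mass_eq_sum_fiber, Finset.sum_mul]
  refine (Finset.sum_le_sum hone).trans ?_
  rw [Finset.sum_comm]
  -- For fixed `I` and `y` the events are disjoint in `V`, so summing over all subspaces costs
  -- nothing.
  have hI : ∀ I ∈ 𝓘, ∑ V ∈ S, ∑ y, ω y * G V I y ≤ 1 := by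
    intro I _
    rw [Finset.sum_comm, ← hω.sum_eq_one]
    refine Finset.sum_le_sum fun y _ => ?_
    rw [← Finset.mul_sum]
    exact mul_le_of_le_one_right (hω.nonneg y) (sum_mass_fiber_le hW _ S)
  refine (Finset.sum_le_card_nsmul _ _ _ hI).trans (le_of_eq ?_)
  rw [h𝓘, Finset.card_powersetCard, Finset.card_univ, Nat.choose_symm hm, nsmul_eq_mul, mul_one]

end Swap

/-! ### Laws of the Laplacian columns and their normals. -/

section Columns

variable {F : Type*} [Field F] {N : ℕ}

/-- The linear involution which turns a vector of independent entries into a column of the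
Laplacian with the deleted coordinate left out: the `j`-th entry is replaced by minus the sum of all
the entries. -/
def colMap (F : Type*) [Field F] {N : ℕ} (j : Fin N) : (Fin N → F) ≃ₗ[F] (Fin N → F) :=
  LinearEquiv.ofInvolutive
    { toFun := fun z k => if k = j then -∑ i, z i else z k
      map_add' := fun x y => by
        ext k
        by_cases h : k = j <;> simp [h, Finset.sum_add_distrib, add_comm]
      map_smul' := fun c x => by
        ext k
        by_cases h : k = j <;> simp [h, Finset.mul_sum] }
    (fun z => by
      ext k
      by_cases h : k = j
      · subst h
        have h1 : ∀ i, (if i = k then -∑ l, z l else z i) =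
            z i + if i = k then -∑ l, z l - z k else 0 := by
          intro i
          by_cases hi : i = k <;> simp [hi]
        simp [h1, Finset.sum_add_distrib]
      · simp [h])

lemma colMap_apply (j : Fin N) (z : Fin N → F) (k : Fin N) :
    colMap F j z k = if k = j then -∑ i, z i else z k := rfl

lemma colMap_colMap (j : Fin N) (z : Fin N → F) : colMap F j (colMap F j z) = z :=
  (colMap F j).symm_apply_apply z

/-- The coefficients of the linear form `z ↦ w ⬝ᵥ colMap F j z`. -/
def colCoeff (w : Fin N → F) (j k : Fin N) : F := if k = j then -w j else w k - w j

lemma dotProduct_colMap (w : Fin N → F) (j : Fin N) (z : Fin N → F) :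
    w ⬝ᵥ colMap F j z = colCoeff w j ⬝ᵥ z := by
  have h1 : ∀ k, w k * colMap F j z k =
      (if k = j then 0 else w k * z k) + if k = j then -(w j * ∑ i, z i) else 0 := by
    intro k
    rw [colMap_apply]
    by_cases hk : k = j <;> simp [hk]
  have h2 : ∀ k, colCoeff w j k * z k = (if k = j then 0 else w k * z k) - w j * z k := by
    intro k
    rw [colCoeff]
    by_cases hk : k = j
    · simp [hk]
    · simp [hk, sub_mul]
  simp only [dotProduct, h1, h2, Finset.sum_add_distrib, Finset.sum_sub_distrib, ← Finset.mul_sum]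
  simp [sub_eq_add_neg]

/-- The vector `w` takes no value on all but fewer than `h` of its coordinates. -/
def Spread [DecidableEq F] (h : ℕ) (w : Fin N → F) : Prop :=
  ∀ s, h ≤ (Finset.univ.filter fun k => w k ≠ s).card

lemma Spread.le_card_colCoeff [DecidableEq F] {h : ℕ} {w : Fin N → F} (hw : Spread h w) (j : Fin N) :
    h ≤ (Finset.univ.filter fun k => colCoeff w j k ≠ 0).card := by
  refine (hw (w j)).trans (Finset.card_le_card fun k hk => ?_)
  simp only [Finset.mem_filter, Finset.mem_univ, true_and] at hk ⊢
  have : k ≠ j := fun h => hk (by rw [h])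
  simpa [colCoeff, this, sub_eq_zero] using hk

/-- The hyperplane of vectors orthogonal to `w`. -/
def dotKer (w : Fin N → F) : Submodule F (Fin N → F) where
  carrier := {c | w ⬝ᵥ c = 0}
  zero_mem' := by simp
  add_mem' := fun {x y} hx hy => by
    simp only [Set.mem_ofPred_eq] at hx hy ⊢
    rw [dotProduct_add, hx, hy, add_zero]
  smul_mem' := fun c x hx => by
    simp only [Set.mem_ofPred_eq] at hx ⊢
    rw [dotProduct_smul, hx, smul_zero]

lemma mem_dotKer {w c : Fin N → F} : c ∈ dotKer w ↔ w ⬝ᵥ c = 0 := Iff.rfl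

lemma dotKer_ne_top {w : Fin N → F} (hw : w ≠ 0) : dotKer w ≠ ⊤ := by
  intro h
  refine hw (funext fun k => ?_)
  have : Pi.single k 1 ∈ dotKer w := h ▸ Submodule.mem_top
  simpa [mem_dotKer] using this

lemma exists_normal {V : Submodule F (Fin N → F)} (hV : V ≠ ⊤) : ∃ w ≠ 0, V ≤ dotKer w := by
  obtain ⟨f, hf, hle⟩ := Submodule.exists_le_ker_of_lt_top V hV.lt_top
  have h1 : ∀ c, f c = (fun k => f (Pi.single k 1)) ⬝ᵥ c := by
    intro c
    conv_lhs => rw [← (Pi.basisFun F (Fin N)).sum_repr c]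
    simp [dotProduct, mul_comm]
  refine ⟨fun k => f (Pi.single k 1), fun h0 => hf ?_, fun c hc => ?_⟩
  · ext1 c
    simp [h0] at h1
    ext
    simp [h1]
  · rw [mem_dotKer, ← h1]
    exact hle hc

lemma span_le_dotKer {k : ℕ} {x : Fin k → Fin N → F} {w : Fin N → F} :
    Submodule.span F (Set.range x) ≤ dotKer w ↔ ∀ i, w ⬝ᵥ x i = 0 := by
  rw [Submodule.span_le]
  exact Set.range_subset_iff

lemma exists_normal_of_lt {k : ℕ} {x : Fin k → Fin N → F} (hk : k < N) :
    ∃ w ≠ 0, ∀ i, w ⬝ᵥ x i = 0 := by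
  have hV : Submodule.span F (Set.range x) ≠ ⊤ := by
    intro h
    have := finrank_range_le_card (R := F) x
    rw [Set.finrank, h, finrank_top] at this
    simp at this
    omega
  obtain ⟨w, hw, hle⟩ := exists_normal hV
  exact ⟨w, hw, span_le_dotKer.1 hle⟩

/-- The weight of the `j`-th column. -/
def colWeight (q : F → ℝ) (j : Fin N) : (Fin N → F) → ℝ := iidWeight q N ∘ colMap F j

/-- The sequence of the weights of the columns. -/
def colSeq (q : F → ℝ) (N : ℕ) (j : ℕ) : (Fin N → F) → ℝ :=
  if h : j < N then colWeight q ⟨j, h⟩ else iidWeight q N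

lemma colSeq_of_lt (q : F → ℝ) {j : ℕ} (h : j < N) : colSeq q N j = colWeight q ⟨j, h⟩ := dif_pos h

variable [Fintype F] {q : F → ℝ} {a : ℝ}

lemma isProbWeight_colWeight (hq : IsProbWeight q) (j : Fin N) : IsProbWeight (colWeight q j) :=
  (isProbWeight_iidWeight hq N).comp_equiv (colMap F j).toEquiv

lemma mass_colWeight (q : F → ℝ) (j : Fin N) (A : Set (Fin N → F)) :
    mass (colWeight q j) A = mass (iidWeight q N) {z | colMap F j z ∈ A} := by
  rw [← mass_comp_equiv (colMap F j).toEquiv (iidWeight q N)]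
  unfold colWeight
  congr 1
  ext c
  change c ∈ A ↔ colMap F j (colMap F j c) ∈ A
  rw [colMap_colMap]

lemma mass_colWeight_dotKer (q : F → ℝ) (j : Fin N) (w : Fin N → F) :
    mass (colWeight q j) (dotKer w) = mass (iidWeight q N) {z | colCoeff w j ⬝ᵥ z = 0} := by
  rw [mass_colWeight]
  congr 1
  ext z
  change w ⬝ᵥ colMap F j z = 0 ↔ _
  rw [dotProduct_colMap]
  rfl

lemma mass_colWeight_submodule_le (hq : IsProbWeight q) (ha1 : a ≤ 1) (hqa : ∀ r, q r ≤ 1 - a)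
    (j : Fin N) (V : Submodule F (Fin N → F)) :
    mass (colWeight q j) V ≤ (1 - a) ^ (N - Module.finrank F V) := by
  rw [mass_colWeight]
  have h := mass_submodule_le hq ha1 hqa (V.map ((colMap F j).symm : (Fin N → F) →ₗ[F] (Fin N → F)))
  rw [LinearEquiv.finrank_map_eq] at h
  refine le_trans (le_of_eq ?_) h
  congr 1
  ext z
  constructor
  · intro hz
    exact ⟨colMap F j z, hz, (colMap F j).symm_apply_apply z⟩
  · rintro ⟨c, hc, rfl⟩
    change colMap F j ((colMap F j).symm c) ∈ V
    rwa [LinearEquiv.apply_symm_apply]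

lemma one_sub_two_mul_pow_le (ha0 : 0 ≤ a) (ha : a ≤ 1 / 2) (s : ℕ) :
    (1 - 2 * a) ^ s ≤ 1 / (1 + 2 * (a * s)) := by
  have h1 : 1 - 2 * a ≤ Real.exp (-(2 * a)) := by
    have := Real.add_one_le_exp (-(2 * a)); linarith
  have h2 : (1 - 2 * a) ^ s ≤ Real.exp (-(2 * (a * s))) := by
    refine (pow_le_pow_left₀ (by linarith) h1 s).trans (le_of_eq ?_)
    rw [← Real.exp_nat_mul]; congr 1; ring
  refine h2.trans ?_
  have h3 : 0 ≤ a * s := by positivity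
  rw [Real.exp_neg, ← one_div]
  refine one_div_le_one_div_of_le (by linarith) ?_
  have := Real.add_one_le_exp (2 * (a * s))
  linarith

/-- A bound away from 1 that holds even in codimension one or two, where Odlyzko's bound may be
close to 1. -/
lemma mass_dotKer_le_two_thirds [DecidableEq F] (hq : IsProbWeight q) (ha0 : 0 ≤ a) (ha : a ≤ 1 / 2)
    (hqa : ∀ r, q r ≤ 1 - a) {h : ℕ} (hah : 1 ≤ a * h) {w : Fin N → F} (hw : Spread h w)
    (j : Fin N) : mass (colWeight q j) (dotKer w) ≤ 2 / 3 := by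
  rw [mass_colWeight_dotKer]
  refine (mass_linearForm_le hq ha hqa _ _).trans ?_
  have h1 : (1 - 2 * a) ^ (Finset.univ.filter fun k => colCoeff w j k ≠ 0).card ≤ 1 / 3 := by
    refine (pow_le_pow_of_le_one (by linarith) (by linarith) (hw.le_card_colCoeff j)).trans ?_
    refine (one_sub_two_mul_pow_le ha0 ha h).trans ?_
    exact one_div_le_one_div_of_le (by norm_num) (by linarith)
  linarith

lemma isProbWeight_colSeq (hq : IsProbWeight q) (N j : ℕ) : IsProbWeight (colSeq q N j) := by
  unfold colSeq
  split_ifs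
  · exact isProbWeight_colWeight hq _
  · exact isProbWeight_iidWeight hq N

end Columns

/-! ### One-step estimates when a column is added. -/

section Chain

variable {F E : Type*} [Field F] [AddCommGroup E] [Module F E] [Fintype E] {w : ℕ → E → ℝ}

lemma mass_dependent_succ_le (hw : ∀ i, IsProbWeight (w i)) {k : ℕ} (Z : Set (Fin k → E)) {b : ℝ}
    (hb : 0 ≤ b) (h : ∀ x : Fin k → E, LinearIndependent F x → x ∉ Z →
      mass (w k) (Submodule.span F (Set.range x)) ≤ b) :
    mass (prefixWeight w (k + 1)) {x | ¬ LinearIndependent F x} ≤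
      mass (prefixWeight w k) {x | ¬ LinearIndependent F x} + b + mass (prefixWeight w k) Z := by
  classical
  have hp : IsProbWeight (prefixWeight w k) := isProbWeight_prefixWeight fun i _ => hw i
  have hb' : b = ∑ x, prefixWeight w k x * b := by rw [← Finset.sum_mul, hp.sum_eq_one, one_mul]
  rw [mass_prefixWeight_snoc, hb', mass, mass, ← Finset.sum_add_distrib, ← Finset.sum_add_distrib]
  refine Finset.sum_le_sum fun x _ => ?_
  have h0 := hp.nonneg x
  have h1 := mul_le_of_le_one_right h0 (mass_le_one (hw k)
    {c | (Fin.snoc x c : Fin (k + 1) → E) ∈ {x : Fin (k + 1) → E | ¬ LinearIndependent F x}})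
  have hZ0 := Set.indicator_nonneg (s := Z) (fun x _ => hp.nonneg x) x
  have hpb := mul_nonneg h0 hb
  by_cases hx : LinearIndependent F x
  · rw [Set.indicator_of_notMem (by simpa using hx)]
    by_cases hxZ : x ∈ Z
    · rw [Set.indicator_of_mem hxZ]
      linarith
    · have h2 : mass (w k)
          {c | (Fin.snoc x c : Fin (k + 1) → E) ∈ {x : Fin (k + 1) → E | ¬ LinearIndependent F x}} ≤ b := by
        refine le_trans (le_of_eq ?_) (h x hx hxZ)
        congr 1
        ext c
        simp [linearIndependent_finSnoc, hx]
      have := mul_le_mul_of_nonneg_left h2 h0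
      linarith
  · rw [Set.indicator_of_mem (by simpa using hx)]
    linarith

/-- A property `G` that persists whenever the new vector leaves the span loses at most the
conditional probability `y` of not leaving it. -/
lemma one_sub_mul_mass_le (hw : ∀ i, IsProbWeight (w i)) {k : ℕ} {G : Set (Fin k → E)}
    {G' : Set (Fin (k + 1) → E)} {y : ℝ}
    (h : ∀ x ∈ G, mass (w k) (Submodule.span F (Set.range x)) ≤ y)
    (hGG : ∀ x ∈ G, ∀ c ∉ Submodule.span F (Set.range x), (Fin.snoc x c : Fin (k + 1) → E) ∈ G') :
    (1 - y) * mass (prefixWeight w k) G ≤ mass (prefixWeight w (k + 1)) G' := by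
  have hp : IsProbWeight (prefixWeight w k) := isProbWeight_prefixWeight fun i _ => hw i
  rw [mass_prefixWeight_snoc, mass, Finset.mul_sum]
  refine Finset.sum_le_sum fun x _ => ?_
  by_cases hx : x ∈ G
  · rw [Set.indicator_of_mem hx, mul_comm]
    refine mul_le_mul_of_nonneg_left ?_ (hp.nonneg x)
    refine le_trans ?_ (mass_mono (hw k) (A := (Submodule.span F (Set.range x) : Set E)ᶜ)
      fun c hc => hGG x hx c hc)
    rw [mass_compl (hw k)]
    linarith [h x hx]
  · rw [Set.indicator_of_notMem hx, mul_zero]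
    exact mul_nonneg (hp.nonneg x) (mass_nonneg (hw k) _)

end Chain

/-! ### Spread normals with heavy hyperplanes. -/

section Bad

variable {p : ℕ} [Fact p.Prime] {q : ZMod p → ℝ} {a : ℝ}

/-- The first `k` columns are independent, and each of their normals is spread and orthogonal to
some column with probability at least `τ`. -/
def badSet (q : ZMod p → ℝ) (N h : ℕ) (τ : ℝ) (k : ℕ) : Set (Fin k → Fin N → ZMod p) :=
  {x | LinearIndependent (ZMod p) x ∧ ∀ w ≠ 0, (∀ i, w ⬝ᵥ x i = 0) →
    Spread h w ∧ ∃ j : Fin N, τ ≤ mass (colWeight q j) (dotKer w)}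

/-- Normals of a longer family are normals of the shorter one, so badness persists under independent
extension. The losses `1 - y` multiply to a bounded factor because Odlyzko's bounds form a geometric
series. -/
lemma mass_badSet_le_exp (hq : IsProbWeight q) (ha0 : 0 < a) (ha : a ≤ 1 / 2)
    (hqa : ∀ r, q r ≤ 1 - a) {N h : ℕ} (hah : 1 ≤ a * h) (τ : ℝ) (d k : ℕ) (hk : k + d + 1 = N) :
    mass (prefixWeight (colSeq q N) k) (badSet q N h τ k) ≤
      Real.exp (3 * ∑ i ∈ Finset.range d, (1 - a) ^ (i + 2)) *
        mass (prefixWeight (colSeq q N) (N - 1)) (badSet q N h τ (N - 1)) := by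
  induction d generalizing k with
  | zero =>
    obtain rfl : k = N - 1 := by omega
    simp
  | succ d ih =>
    have hw := isProbWeight_colSeq hq N
    have hkN : k < N := by omega
    -- Here `d + 2 = N - k` is the codimension of the span. The cap `2 / 3` is exactly what makes
    -- `(1 + 3 * y) * (1 - y) ≥ 1`, used in `h3`.
    set y := min ((1 - a) ^ (d + 2)) (2 / 3) with hy
    have h1a : 0 ≤ 1 - a := by linarith
    have hy0 : 0 ≤ y := le_min (by positivity) (by norm_num)
    have hy1 : y ≤ 2 / 3 := min_le_right _ _
    have hstep : (1 - y) * mass (prefixWeight (colSeq q N) k) (badSet q N h τ k) ≤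
        mass (prefixWeight (colSeq q N) (k + 1)) (badSet q N h τ (k + 1)) := by
      refine one_sub_mul_mass_le (F := ZMod p) hw (fun x hx => ?_) fun x hx c hc => ?_
      · rw [colSeq_of_lt q hkN]
        refine le_min ?_ ?_
        · refine (mass_colWeight_submodule_le hq (by linarith) hqa _ _).trans (le_of_eq ?_)
          rw [finrank_span_eq_card hx.1, Fintype.card_fin]
          congr 1
          omega
        · obtain ⟨w, hw0, hwx⟩ := exists_normal_of_lt (x := x) hkN
          refine (mass_mono (isProbWeight_colWeight hq _) ?_).trans
            (mass_dotKer_le_two_thirds hq ha0.le ha hqa hah (hx.2 w hw0 hwx).1 ⟨k, hkN⟩)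
          exact span_le_dotKer.2 hwx
      · refine ⟨linearIndependent_finSnoc.2 ⟨hx.1, hc⟩, fun w hw0 hwx => hx.2 w hw0 fun i => ?_⟩
        simpa using hwx i.castSucc
    have h2 := hstep.trans (ih (k + 1) (by omega))
    have h3 : 1 ≤ Real.exp (3 * (1 - a) ^ (d + 2)) * (1 - y) := by
      have h4 : 1 + 3 * y ≤ Real.exp (3 * (1 - a) ^ (d + 2)) := by
        have h5 := Real.add_one_le_exp (3 * (1 - a) ^ (d + 2))
        have h6 : y ≤ (1 - a) ^ (d + 2) := min_le_left _ _
        linarith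
      have := mul_le_mul_of_nonneg_right h4 (show 0 ≤ 1 - y by linarith)
      nlinarith
    have hm0 := mass_nonneg (isProbWeight_prefixWeight (k := k) fun i _ => hw i) (badSet q N h τ k)
    rw [Finset.sum_range_succ, mul_add, add_comm, Real.exp_add]
    have h7 := mul_le_mul_of_nonneg_left h2 (Real.exp_pos (3 * (1 - a) ^ (d + 2))).le
    have h8 := mul_le_mul_of_nonneg_right h3 hm0
    linarith

lemma sum_range_pow_le (ha0 : 0 < a) (ha : a ≤ 1) (d : ℕ) :
    ∑ i ∈ Finset.range d, (1 - a) ^ (i + 2) ≤ 1 / a := by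
  have h1a : 0 ≤ 1 - a := by linarith
  have h1 : ∑ i ∈ Finset.range d, (1 - a) ^ (i + 2) ≤ ∑ i ∈ Finset.range d, (1 - a) ^ i :=
    Finset.sum_le_sum fun i _ => pow_le_pow_of_le_one h1a (by linarith) (by omega)
  refine h1.trans ?_
  rw [le_div_iff₀ ha0]
  have h2 := geom_sum_mul (1 - a) d
  have : 0 ≤ (1 - a) ^ d := by positivity
  nlinarith

/-- The first `N - 1` columns are unlikely to span a hyperplane with a spread normal in which some
column is concentrated. -/
lemma mass_badSet_pred_le (hq : IsProbWeight q) (ha0 : 0 < a) (ha : a ≤ 1 / 2)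
    (hqa : ∀ r, q r ≤ 1 - a) {N h : ℕ} (hN : 1 ≤ N) (hh : 4 * h ≤ N)
    (hp : 1 / (p : ℝ) ≤ Real.exp (-(a * h / 4 ^ 8 / 2))) :
    mass (prefixWeight (colSeq q N) (N - 1))
      (badSet q N h (4 * Real.exp (-(a * h / 4 ^ 8 / 2))) (N - 1)) ≤ N * (1 / 4) ^ (N - 1) := by
  classical
  set θ := Real.exp (-(a * h / 4 ^ 8 / 2)) with hθ
  have hθ0 : 0 < θ := Real.exp_pos _
  set μ : ℝ := 1 / 4 ^ (8 + 1) with hμ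
  have hμ0 : 0 ≤ μ := by positivity
  have hμ1 : μ ≤ 1 := by rw [hμ]; norm_num
  have hql : IsProbWeight (lazyWeight q μ) := isProbWeight_lazyWeight hq hμ0 hμ1
  let 𝒱 : Fin N → Set (Submodule (ZMod p) (Fin N → ZMod p)) := fun j =>
    {V | Module.finrank (ZMod p) V = N - 1 ∧ (∃ w, Spread h w ∧ V = dotKer w) ∧
      4 * θ ≤ mass (colWeight q j) V ∧ ∀ i : Fin N, mass (colWeight q i) V ≤ mass (colWeight q j) V}
  have hNe : Nonempty (Fin N) := ⟨⟨0, hN⟩⟩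
  have hw : ∀ i : Fin (N - 1), IsProbWeight (colSeq q N i) := fun i => isProbWeight_colSeq hq N i
  have hcover : ∀ x ∈ badSet q N h (4 * θ) (N - 1), ∃ j ∈ Finset.univ,
      x ∈ {x : Fin (N - 1) → Fin N → ZMod p | Submodule.span (ZMod p) (Set.range x) ∈ 𝒱 j} := by
    intro x hx
    obtain ⟨w, hw0, hwx⟩ := exists_normal_of_lt (x := x) (show N - 1 < N by omega)
    obtain ⟨hspread, j₀, hj₀⟩ := hx.2 w hw0 hwx
    have hrank : Module.finrank (ZMod p) (Submodule.span (ZMod p) (Set.range x)) = N - 1 := by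
      rw [finrank_span_eq_card hx.1, Fintype.card_fin]
    have hlt : Module.finrank (ZMod p) (dotKer w) < N := by
      have := Submodule.finrank_lt (dotKer_ne_top hw0)
      simpa using this
    have hspan : Submodule.span (ZMod p) (Set.range x) = dotKer w :=
      Submodule.eq_of_le_of_finrank_le (span_le_dotKer.2 hwx) (by omega)
    -- Different columns have different laws, while the swap needs one law dominating all of them on
    -- `V`. Sorting hyperplanes by the maximising index costs the factor `N`.
    obtain ⟨j, hj⟩ := Finite.exists_max fun i : Fin N => mass (colWeight q i) (dotKer w)
    refine ⟨j, Finset.mem_univ j, hrank, ⟨w, hspread, hspan⟩, ?_, ?_⟩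
    · rw [hspan]; exact hj₀.trans (hj j₀)
    · rw [hspan]; exact hj
  refine (mass_le_sum (isProbWeight_prefixWeight fun i _ => isProbWeight_colSeq hq N i)
    Finset.univ _ _ hcover).trans ?_
  have hj : ∀ j : Fin N, mass (prefixWeight (colSeq q N) (N - 1))
      {x : Fin (N - 1) → Fin N → ZMod p | Submodule.span (ZMod p) (Set.range x) ∈ 𝒱 j} ≤
        (1 / 4) ^ (N - 1) := by
    intro j
    have hη := isProbWeight_colWeight hql j
    have key := mass_span_mem_le (F := ZMod p) hw hη (m := N / 2) (C := 64)
      (by rw [Fintype.card_fin]; omega) (by norm_num) (𝒱 j)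
      (fun V hV => by rw [Fintype.card_fin]; exact hV.1) (fun V => mass (colWeight q j) V)
      (fun V hV => lt_of_lt_of_le (by positivity) hV.2.2.1)
      (fun V hV i => by
        rw [colSeq_of_lt q (show (i : ℕ) < N by omega)]
        exact hV.2.2.2 _)
      (fun V hV U hU => by
        obtain ⟨-, ⟨w, hspread, rfl⟩, hτ, -⟩ := hV
        have h1 := mass_le_mass_lazy hq ha0.le hqa 8 (colCoeff w j) (hspread.le_card_colCoeff j)
        rw [← mass_colWeight_dotKer, ← mass_colWeight_dotKer, ← hμ, ← hθ] at h1
        have h2 : mass (colWeight (lazyWeight q μ) j) U ≤ θ := by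
          refine (mass_colWeight_submodule_le hql (a := μ * a) (by nlinarith)
            (lazyWeight_le hq hqa hμ0 hμ1) j U).trans ?_
          have h3 : 1 - μ * a ≤ Real.exp (-(μ * a)) := by
            have := Real.add_one_le_exp (-(μ * a)); linarith
          refine (pow_le_pow_left₀ (by nlinarith) h3 _).trans ?_
          rw [← Real.exp_nat_mul, hθ]
          refine Real.exp_le_exp.2 ?_
          -- Since `dim U < N / 2` and `4 * h ≤ N`, the codimension is at least `2 * h`. With
          -- laziness `μ = 1 / 4 ^ 9`, Odlyzko's exponent is then exactly that of `θ`.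
          have h4 : (2 * h : ℝ) ≤ ((N - Module.finrank (ZMod p) U : ℕ) : ℝ) := by
            have : 2 * h ≤ N - Module.finrank (ZMod p) U := by omega
            exact_mod_cast this
          have h5 := mul_le_mul_of_nonneg_right h4 (mul_nonneg hμ0 ha0.le)
          have h6 : (2 * h : ℝ) * (μ * a) = a * h / 4 ^ 8 / 2 := by rw [hμ]; ring
          rw [mul_neg, ← h6]
          exact neg_le_neg h5
        -- As `1 / p ≤ θ` and `A₁ ≥ 4 * θ`, the comparison yields `A₂ ≥ 256 * (A₁ - 2 * θ) ≥ 128 *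
        -- A₁`. Subtracting `A₃ ≤ θ` leaves more than `64 * A₁`.
        rw [show (2 : ℝ) ^ 8 = 256 by norm_num] at h1
        generalize mass (colWeight q j) (dotKer w) = A₁ at h1 hτ ⊢
        generalize mass (colWeight (lazyWeight q μ) j) (dotKer w) = A₂ at h1 ⊢
        generalize mass (colWeight (lazyWeight q μ) j) U = A₃ at h2 ⊢
        clear_value θ
        linarith)
    refine key.trans ?_
    rw [Fintype.card_fin, div_le_iff₀ (by positivity)]
    have h1 : (((N - 1).choose (N / 2) : ℕ) : ℝ) ≤ 2 ^ (N - 1) := by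
      exact_mod_cast Nat.choose_le_two_pow (N - 1) (N / 2)
    have h2 : (8 : ℝ) ^ (N - 1) ≤ 64 ^ (N / 2) := by
      rw [show (64 : ℝ) = 8 ^ 2 by norm_num, ← pow_mul]
      exact pow_le_pow_right₀ (by norm_num) (by omega)
    calc (((N - 1).choose (N / 2) : ℕ) : ℝ) ≤ 2 ^ (N - 1) := h1
      _ = (1 / 4) ^ (N - 1) * 8 ^ (N - 1) := by rw [← mul_pow]; norm_num
      _ ≤ _ := mul_le_mul_of_nonneg_left h2 (by positivity)
  refine (Finset.sum_le_card_nsmul _ _ _ fun j _ => hj j).trans (le_of_eq ?_)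
  simp

end Bad

/-! ### Nearly constant normals. -/

section Sparse

variable {F : Type*} [Field F] {N : ℕ}

/-- The nonzero vectors which take some value exactly on the complement of `S`. -/
def constOff (S : Finset (Fin N)) : Set (Fin N → F) :=
  {v | v ≠ 0 ∧ ∃ s, ∀ k, v k ≠ s ↔ k ∈ S}

lemma exists_submodule_constOff (S : Finset (Fin N)) :
    ∃ W : Submodule F (Fin N → F), Module.finrank F W ≤ S.card + 1 ∧ constOff S ⊆ (W : Set (Fin N → F)) := by
  classical
  let e : Option S → (Fin N → F) := fun o => o.elim (fun _ => 1) fun k => Pi.single k.1 1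
  refine ⟨Submodule.span F (Set.range e), ?_, ?_⟩
  · have := finrank_range_le_card (R := F) e
    simpa [Set.finrank] using this
  · rintro v ⟨-, s, hs⟩
    have hv : v = s • e none + ∑ k : S, (v k - s) • e (some k) := by
      ext i
      simp only [Pi.add_apply, Pi.smul_apply, Finset.sum_apply, e, Option.elim, smul_eq_mul, mul_one]
      by_cases hi : i ∈ S
      · rw [Finset.sum_eq_single (⟨i, hi⟩ : S)]
        · simp
        · intro k _ hk
          have : i ≠ k.1 := fun h => hk (Subtype.ext h.symm)
          simp [this]
        · simp
      · rw [Finset.sum_eq_zero]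
        · have := mt (hs i).1 hi
          push Not at this
          simp [this]
        · intro k _
          have : i ≠ k.1 := fun h => hi (h ▸ k.2)
          simp [this]
    rw [hv]
    exact add_mem (Submodule.smul_mem _ _ (Submodule.subset_span ⟨none, rfl⟩))
      (Submodule.sum_mem _ fun k _ => Submodule.smul_mem _ _ (Submodule.subset_span ⟨some k, rfl⟩))

variable [Fintype F]

/-- Independent random vectors have a common normal in a given set of vectors, within a given
subspace, only if few of them cut down the dimension of the space of common normals. -/
lemma mass_exists_normal_le {L : ℝ} (hL : 1 ≤ L) (G : Set (Fin N → F)) (k : ℕ)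
    (w : ℕ → (Fin N → F) → ℝ) (hw : ∀ i, IsProbWeight (w i)) (b : ℕ → ℝ) (hb0 : ∀ i, 0 ≤ b i)
    (hb : ∀ i < k, (∀ v ∈ G, mass (w i) (dotKer v) + 1 / L ≤ b i) ∨ 1 ≤ b i)
    (W : Submodule F (Fin N → F)) :
    mass (prefixWeight w k) {x | ∃ v ∈ G, v ∈ W ∧ ∀ i, v ⬝ᵥ x i = 0} ≤
      L ^ Module.finrank F W * ∏ i ∈ Finset.range k, b i := by
  classical
  have hL0 : 0 < L := by linarith
  induction k generalizing w b W with
  | zero =>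
    simp only [Finset.range_zero, Finset.prod_empty, mul_one]
    exact (mass_le_one (isProbWeight_prefixWeight fun i _ => hw i) _).trans (one_le_pow₀ hL)
  | succ k ih =>
    by_cases hne : ∃ v ∈ G, v ∈ W
    swap
    · have : {x : Fin (k + 1) → Fin N → F | ∃ v ∈ G, v ∈ W ∧ ∀ i, v ⬝ᵥ x i = 0} = ∅ := by
        ext x
        simp only [Set.mem_ofPred_eq, Set.mem_empty_iff_false, iff_false]
        rintro ⟨v, hvG, hvW, -⟩
        exact hne ⟨v, hvG, hvW⟩
      rw [this]
      simp only [mass, Set.indicator_empty, Finset.sum_const_zero]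
      exact mul_nonneg (by positivity) (Finset.prod_nonneg fun i _ => hb0 i)
    obtain ⟨v, hvG, hvW⟩ := hne
    rw [mass_prefixWeight_cons, Finset.prod_range_succ', mul_comm (∏ i ∈ _, _), ← mul_assoc]
    set R := ∏ i ∈ Finset.range k, b (i + 1) with hR
    have hR0 : 0 ≤ R := Finset.prod_nonneg fun i _ => hb0 _
    have hc : ∀ c, mass (prefixWeight (fun i => w (i + 1)) k)
        {x | (Fin.cons c x : Fin (k + 1) → Fin N → F) ∈ {x | ∃ v ∈ G, v ∈ W ∧ ∀ i, v ⬝ᵥ x i = 0}} ≤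
        L ^ Module.finrank F (W ⊓ dotKer c : Submodule F _) * R := by
      intro c
      refine le_trans (le_of_eq ?_) (ih (fun i => w (i + 1)) (fun i => hw _) (fun i => b (i + 1))
        (fun i => hb0 _) (fun i hi => hb (i + 1) (by omega)) (W ⊓ dotKer c))
      congr 1
      ext x
      simp only [Set.mem_ofPred_eq, Fin.forall_fin_succ, Fin.cons_zero, Fin.cons_succ,
        Submodule.mem_inf, mem_dotKer]
      constructor
      · rintro ⟨v, h1, h2, h3, h4⟩
        exact ⟨v, h1, ⟨h2, by rwa [dotProduct_comm]⟩, h4⟩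
      · rintro ⟨v, h1, ⟨h2, h3⟩, h4⟩
        exact ⟨v, h1, h2, by rwa [dotProduct_comm], h4⟩
    have hmono : ∀ c, L ^ Module.finrank F (W ⊓ dotKer c : Submodule F _) ≤ L ^ Module.finrank F W :=
      fun c => pow_le_pow_right₀ hL (Submodule.finrank_mono inf_le_left)
    have hmain : ∑ c, w 0 c * L ^ Module.finrank F (W ⊓ dotKer c : Submodule F _) ≤
        L ^ Module.finrank F W * b 0 := by
      rcases hb 0 (by omega) with h | h
      -- Fix one candidate `v`. A column orthogonal to `v` may leave `W` unchanged; any other column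
      -- removes `v` from the candidate space, so the dimension drops and the potential falls by a
      -- factor `L`.
      · have hterm : ∀ c, w 0 c * L ^ Module.finrank F (W ⊓ dotKer c : Submodule F _) ≤
            L ^ Module.finrank F W * ((dotKer v : Set (Fin N → F)).indicator (w 0) c + w 0 c * (1 / L)) := by
          intro c
          have hw0 := (hw 0).nonneg c
          have hLp : 0 ≤ L ^ Module.finrank F W := by positivity
          by_cases hcv : c ∈ dotKer v
          · rw [Set.indicator_of_mem (show c ∈ (dotKer v : Set (Fin N → F)) from hcv)]
            have h1 := mul_le_mul_of_nonneg_left (hmono c) hw0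
            have h2 : 0 ≤ L ^ Module.finrank F W * (w 0 c * (1 / L)) := by positivity
            linarith
          · rw [Set.indicator_of_notMem (show c ∉ (dotKer v : Set (Fin N → F)) from hcv), zero_add]
            have hlt : (W ⊓ dotKer c : Submodule F _) < W := by
              refine lt_of_le_of_ne inf_le_left fun heq => hcv ?_
              have : v ∈ W ⊓ dotKer c := by rw [heq]; exact hvW
              have h2 := this.2
              change c ⬝ᵥ v = 0 at h2
              rwa [mem_dotKer, dotProduct_comm]
            have hrk := Submodule.finrank_lt_finrank_of_lt hlt
            have h1 : L ^ Module.finrank F (W ⊓ dotKer c : Submodule F _) * L ≤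
                L ^ Module.finrank F W := by
              rw [← pow_succ]
              exact pow_le_pow_right₀ hL hrk
            have h2 : L ^ Module.finrank F (W ⊓ dotKer c : Submodule F _) ≤
                L ^ Module.finrank F W * (1 / L) := by
              rw [mul_one_div, le_div_iff₀ hL0]
              exact h1
            calc _ ≤ w 0 c * (L ^ Module.finrank F W * (1 / L)) := mul_le_mul_of_nonneg_left h2 hw0
              _ = _ := by ring
        refine (Finset.sum_le_sum fun c _ => hterm c).trans ?_
        rw [← Finset.mul_sum, Finset.sum_add_distrib, ← Finset.sum_mul, (hw 0).sum_eq_one, one_mul]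
        exact mul_le_mul_of_nonneg_left (h v hvG) (by positivity)
      · refine (Finset.sum_le_sum fun c _ =>
          mul_le_mul_of_nonneg_left (hmono c) ((hw 0).nonneg c)).trans ?_
        rw [← Finset.sum_mul, (hw 0).sum_eq_one, one_mul]
        exact le_mul_of_one_le_right (by positivity) h
    calc _ ≤ ∑ c, w 0 c * (L ^ Module.finrank F (W ⊓ dotKer c : Submodule F _) * R) :=
          Finset.sum_le_sum fun c _ => mul_le_mul_of_nonneg_left (hc c) ((hw 0).nonneg c)
      _ = (∑ c, w 0 c * L ^ Module.finrank F (W ⊓ dotKer c : Submodule F _)) * R := by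
          rw [Finset.sum_mul]
          exact Finset.sum_congr rfl fun c _ => by ring
      _ ≤ _ := mul_le_mul_of_nonneg_right hmain hR0

variable [DecidableEq F] {q : F → ℝ} {a : ℝ}

/-- For `j ∉ S` the value `v j` is the common one, so the coefficients at `S` are nonzero. If `S` is
empty, `v` is a nonzero constant and the coefficient `-v j` at `j` survives, whence the maximum with
1. -/
lemma mass_dotKer_constOff_le (hq : IsProbWeight q) (ha0 : 0 ≤ a) (ha : a ≤ 1 / 2)
    (hqa : ∀ r, q r ≤ 1 - a) {S : Finset (Fin N)} {v : Fin N → F} (hv : v ∈ constOff S) {j : Fin N}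
    (hj : j ∉ S) :
    mass (colWeight q j) (dotKer v) ≤ (1 + (1 - 2 * a) ^ (max S.card 1)) / 2 := by
  obtain ⟨hv0, s, hs⟩ := hv
  have hvj : v j = s := by by_contra h; exact hj ((hs j).1 h)
  rw [mass_colWeight_dotKer]
  refine (mass_linearForm_le hq ha hqa _ _).trans ?_
  have hcard : max S.card 1 ≤ (Finset.univ.filter fun k => colCoeff v j k ≠ 0).card := by
    rcases S.eq_empty_or_nonempty with rfl | hS
    · simp only [Finset.card_empty, zero_le, sup_of_le_right, Nat.one_le_iff_ne_zero,
        Finset.card_ne_zero]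
      refine ⟨j, ?_⟩
      have : s ≠ 0 := by
        rintro rfl
        exact hv0 (funext fun k => by simpa using hs k)
      simp [colCoeff, hvj, this]
    · rw [max_eq_left hS.card_pos]
      refine Finset.card_le_card fun k hk => ?_
      have hkj : k ≠ j := fun h => hj (h ▸ hk)
      have := (hs k).2 hk
      simp only [Finset.mem_filter, Finset.mem_univ, true_and, colCoeff, if_neg hkj, hvj]
      exact sub_ne_zero.2 this
  have := pow_le_pow_of_le_one (show 0 ≤ 1 - 2 * a by linarith) (by linarith) hcard
  linarith

lemma mass_exists_constOff_le (hq : IsProbWeight q) (ha0 : 0 ≤ a) (ha : a ≤ 1 / 2)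
    (hqa : ∀ r, q r ≤ 1 - a) (S : Finset (Fin N)) {k : ℕ} (hk : k ≤ N) {L B : ℝ} (hL : 1 ≤ L)
    (hB : (1 + (1 - 2 * a) ^ (max S.card 1)) / 2 + 1 / L ≤ B) (hB1 : B ≤ 1) :
    mass (prefixWeight (colSeq q N) k) {x | ∃ v ∈ constOff S, ∀ i, v ⬝ᵥ x i = 0} ≤
      L ^ (S.card + 1) * B ^ (k - S.card) := by
  have hB0 : 0 ≤ B := by
    have h1 : 0 ≤ (1 - 2 * a) ^ (max S.card 1) := pow_nonneg (by linarith) _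
    have h2 : 0 ≤ 1 / L := by positivity
    linarith
  obtain ⟨W, hWdim, hW⟩ := exists_submodule_constOff (F := F) S
  let S' : Finset ℕ := S.map Fin.valEmbedding
  -- Columns with index in `S` receive the trivial factor 1, since there `v j` is not the common
  -- value. This loses at most `S.card` factors `B`.
  have h := mass_exists_normal_le hL (constOff S) k (colSeq q N) (isProbWeight_colSeq hq N)
    (fun i => if i ∉ S' then B else 1) (fun i => by split_ifs <;> linarith) (fun i hi => by
      by_cases hiS : i ∈ S'
      · right; simp [hiS]
      · left
        intro v hv
        rw [colSeq_of_lt q (show i < N by omega), if_pos hiS]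
        have hj : (⟨i, by omega⟩ : Fin N) ∉ S := fun h' =>
          hiS (Finset.mem_map.2 ⟨_, h', rfl⟩)
        linarith [mass_dotKer_constOff_le hq ha0 ha hqa hv hj]) W
  have hset : {x : Fin k → Fin N → F | ∃ v ∈ constOff S, ∀ i, v ⬝ᵥ x i = 0} ⊆
      {x | ∃ v ∈ constOff S, v ∈ W ∧ ∀ i, v ⬝ᵥ x i = 0} := by
    rintro x ⟨v, hv, hvx⟩
    exact ⟨v, hv, hW hv, hvx⟩
  refine (mass_mono (isProbWeight_prefixWeight fun i _ => isProbWeight_colSeq hq N i) hset).trans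
    (h.trans ?_)
  have hprod : ∏ i ∈ Finset.range k, (if i ∉ S' then B else 1) ≤ B ^ (k - S.card) := by
    rw [← Finset.prod_filter, Finset.prod_const]
    refine pow_le_pow_of_le_one hB0 hB1 ?_
    have h1 := Finset.le_card_sdiff S' (Finset.range k)
    rw [Finset.card_range, Finset.card_map] at h1
    rwa [Finset.sdiff_eq_filter] at h1
  refine mul_le_mul (pow_le_pow_right₀ hL hWdim) hprod ?_ (by positivity)
  exact Finset.prod_nonneg fun i _ => by split_ifs <;> linarith

lemma mass_exists_constOff_le_add (hq : IsProbWeight q) (ha0 : 0 < a) (ha : a ≤ 1 / 2)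
    (hqa : ∀ r, q r ≤ 1 - a) (S : Finset (Fin N)) {k h : ℕ} (hk : k ≤ N) (hk3 : 3 * N ≤ 4 * k)
    (hS : S.card < h) (hh : 200 * h ≤ N)
    (hT : (6 / a) ^ 2 * Real.exp (-(a * N / 12)) ≤ Real.exp (-(a * N / 24)) / N) :
    mass (prefixWeight (colSeq q N) k) {x | ∃ v ∈ constOff S, ∀ i, v ⬝ᵥ x i = 0} ≤
      Real.exp (-(a * N / 24)) * (1 / N) ^ S.card +
        12 * 1200 ^ h * (87 / 100) ^ N * (1 / 100) ^ S.card := by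
  have hN : 1 ≤ N := by omega
  have hN' : (1 : ℝ) ≤ N := by exact_mod_cast hN
  set s := max S.card 1 with hs
  have hs1 : 1 ≤ s := le_max_right _ _
  have hsS : S.card ≤ s := le_max_left _ _
  set r := k - S.card with hr
  have hrN : N ≤ 2 * r := by omega
  have hrN' : (N : ℝ) ≤ 2 * r := by exact_mod_cast hrN
  have hpow := one_sub_two_mul_pow_le ha0.le ha s
  set x := a * s with hx
  have hs1' : (1 : ℝ) ≤ s := by exact_mod_cast hs1
  have hx0 : 0 < x := by positivity
  -- For small `x` the atom bound is `1 - x / 3`, and `L = 6 / x` gives up half of the gap. For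
  -- large `x` the atom bound is `2 / 3`, and `L = 12` leaves `3 / 4`.
  by_cases hx1 : x ≤ 1
  · have h1 : 1 / (1 + 2 * x) ≤ 1 - 2 * x / 3 := by
      rw [div_le_iff₀ (by linarith)]
      nlinarith
    have hL : 1 ≤ 6 / x := by rw [le_div_iff₀ hx0]; linarith
    have hLa : 6 / x ≤ 6 / a := by
      refine div_le_div_of_nonneg_left (by norm_num) ha0 ?_
      rw [hx]; nlinarith
    have h2 := mass_exists_constOff_le hq ha0.le ha hqa S hk hL (B := 1 - x / 6) (by
      rw [one_div_div]; linarith) (by linarith)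
    have h3 : (1 - x / 6) ^ r ≤ Real.exp (-(a * N / 12)) ^ s := by
      have h4 : 1 - x / 6 ≤ Real.exp (-(x / 6)) := by
        have := Real.add_one_le_exp (-(x / 6)); linarith
      refine (pow_le_pow_left₀ (by linarith) h4 r).trans ?_
      rw [← Real.exp_nat_mul, ← Real.exp_nat_mul]
      refine Real.exp_le_exp.2 ?_
      have := mul_le_mul_of_nonneg_left hrN' hx0.le
      rw [hx] at this ⊢
      linarith
    have h5 : (6 / x) ^ (S.card + 1) ≤ ((6 / a) ^ 2) ^ s := by
      rw [← pow_mul]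
      refine (pow_le_pow_left₀ (by positivity) hLa _).trans
        (pow_le_pow_right₀ (hL.trans hLa) (by omega))
    have h6 : 0 ≤ 12 * 1200 ^ h * (87 / 100 : ℝ) ^ N * (1 / 100) ^ S.card := by positivity
    have hT1 : Real.exp (-(a * N / 24)) ≤ 1 := Real.exp_le_one_iff.2 (by
      have : 0 ≤ a * N / 24 := by positivity
      linarith)
    calc _ ≤ (6 / x) ^ (S.card + 1) * (1 - x / 6) ^ r := h2
      _ ≤ ((6 / a) ^ 2) ^ s * Real.exp (-(a * N / 12)) ^ s :=
          mul_le_mul h5 h3 (pow_nonneg (by linarith) _) (by positivity)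
      _ = ((6 / a) ^ 2 * Real.exp (-(a * N / 12))) ^ s := by rw [mul_pow]
      _ ≤ (Real.exp (-(a * N / 24)) / N) ^ s := pow_le_pow_left₀ (by positivity) hT s
      _ = Real.exp (-(a * N / 24)) ^ s * (1 / N) ^ s := by rw [← mul_pow, mul_one_div]
      _ ≤ Real.exp (-(a * N / 24)) ^ 1 * (1 / N) ^ S.card := by
          refine mul_le_mul (pow_le_pow_of_le_one (Real.exp_pos _).le hT1 hs1)
            (pow_le_pow_of_le_one (by positivity) ?_ hsS) (by positivity) (by positivity)
          rw [div_le_one (by linarith)]; exact hN'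
      _ ≤ _ := by rw [pow_one]; linarith
  · push Not at hx1
    have h1 : 1 / (1 + 2 * x) ≤ 1 / 3 := one_div_le_one_div_of_le (by norm_num) (by linarith)
    have h2 := mass_exists_constOff_le hq ha0.le ha hqa S hk (L := 12) (by norm_num) (B := 3 / 4) (by
      linarith) (by norm_num)
    have h3 : (3 / 4 : ℝ) ^ r ≤ (87 / 100) ^ N := by
      calc (3 / 4 : ℝ) ^ r ≤ ((87 / 100) ^ 2) ^ r := pow_le_pow_left₀ (by norm_num) (by norm_num) _
        _ = (87 / 100) ^ (2 * r) := by rw [pow_mul]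
        _ ≤ _ := pow_le_pow_of_le_one (by norm_num) (by norm_num) hrN
    have h4 : (12 : ℝ) ^ (S.card + 1) ≤ 12 * 1200 ^ h * (1 / 100) ^ S.card := by
      have h5 : (1200 : ℝ) ^ S.card ≤ 1200 ^ h := pow_le_pow_right₀ (by norm_num) hS.le
      calc (12 : ℝ) ^ (S.card + 1) = 12 * 1200 ^ S.card * (1 / 100) ^ S.card := by
            rw [mul_assoc, ← mul_pow, pow_succ']; norm_num
        _ ≤ _ := by gcongr
    have h6 : 0 ≤ Real.exp (-(a * N / 24)) * (1 / N) ^ S.card := by positivity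
    calc _ ≤ (12 : ℝ) ^ (S.card + 1) * (3 / 4) ^ r := h2
      _ ≤ 12 * 1200 ^ h * (1 / 100) ^ S.card * (87 / 100) ^ N :=
          mul_le_mul h4 h3 (by positivity) (by positivity)
      _ ≤ _ := by linarith

lemma sum_pow_card (y : ℝ) : ∑ S : Finset (Fin N), y ^ S.card = (1 + y) ^ N := by
  have := Fintype.sum_pow_mul_eq_add_pow (Fin N) y 1
  simpa [add_comm] using this

/-- Most columns are unlikely to have a common normal that is not spread. -/
theorem mass_exists_not_spread_le (hq : IsProbWeight q) (ha0 : 0 < a) (ha : a ≤ 1 / 2)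
    (hqa : ∀ r, q r ≤ 1 - a) {k h : ℕ} (hN : 1 ≤ N) (hk : k ≤ N) (hk3 : 3 * N ≤ 4 * k) (hh : 200 * h ≤ N)
    (hT : (6 / a) ^ 2 * Real.exp (-(a * N / 12)) ≤ Real.exp (-(a * N / 24)) / N) :
    mass (prefixWeight (colSeq q N) k) {x | ∃ v ≠ 0, ¬ Spread h v ∧ ∀ i, v ⬝ᵥ x i = 0} ≤
      3 * Real.exp (-(a * N / 24)) + 12 * (92 / 100) ^ N := by
  have hN' : (1 : ℝ) ≤ N := by exact_mod_cast hN
  set 𝓢 := Finset.univ.filter fun S : Finset (Fin N) => S.card < h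
  refine (mass_le_sum (isProbWeight_prefixWeight fun i _ => isProbWeight_colSeq hq N i) 𝓢 _
    (fun S => {x | ∃ v ∈ constOff S, ∀ i, v ⬝ᵥ x i = 0}) ?_).trans ?_
  · rintro x ⟨v, hv0, hv, hvx⟩
    unfold Spread at hv
    push Not at hv
    obtain ⟨s, hs⟩ := hv
    exact ⟨Finset.univ.filter fun k => v k ≠ s, by simpa [𝓢] using hs, v, ⟨hv0, s, by simp⟩, hvx⟩
  have hT0 := Real.exp_pos (-(a * N / 24))
  have h1 : (1 + 1 / (N : ℝ)) ^ N ≤ 3 := by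
    have h2 : 1 + 1 / (N : ℝ) ≤ Real.exp (1 / N) := by
      have := Real.add_one_le_exp (1 / (N : ℝ)); linarith
    refine (pow_le_pow_left₀ (by positivity) h2 N).trans ?_
    rw [← Real.exp_nat_mul, mul_one_div_cancel (by linarith)]
    linarith [Real.exp_one_lt_d9]
  -- This is where `200 * h ≤ N` enters: the entropy of the exceptional sets must be beaten by `(87
  -- / 100) ^ N`.
  have h2 : (1200 : ℝ) ^ h ≤ (104 / 100) ^ N := by
    calc (1200 : ℝ) ^ h ≤ ((104 / 100) ^ 200) ^ h := pow_le_pow_left₀ (by norm_num) (by norm_num) _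
      _ = (104 / 100) ^ (200 * h) := by rw [pow_mul]
      _ ≤ _ := pow_le_pow_right₀ (by norm_num) hh
  have h3 : 1200 ^ h * (87 / 100) ^ N * (1 + 1 / 100 : ℝ) ^ N ≤ (92 / 100) ^ N := by
    calc 1200 ^ h * (87 / 100) ^ N * (1 + 1 / 100 : ℝ) ^ N
        ≤ (104 / 100) ^ N * (87 / 100) ^ N * (1 + 1 / 100 : ℝ) ^ N := by gcongr
      _ = (104 / 100 * (87 / 100) * (1 + 1 / 100)) ^ N := by rw [mul_pow, mul_pow]
      _ ≤ _ := pow_le_pow_left₀ (by norm_num) (by norm_num) _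
  calc _ ≤ ∑ S ∈ 𝓢, (Real.exp (-(a * N / 24)) * (1 / N) ^ S.card +
        12 * 1200 ^ h * (87 / 100) ^ N * (1 / 100) ^ S.card) :=
        Finset.sum_le_sum fun S hS => mass_exists_constOff_le_add hq ha0 ha hqa S hk hk3
          (Finset.mem_filter.1 hS).2 hh hT
    _ ≤ ∑ S : Finset (Fin N), (Real.exp (-(a * N / 24)) * (1 / N) ^ S.card +
        12 * 1200 ^ h * (87 / 100) ^ N * (1 / 100) ^ S.card) :=
        Finset.sum_le_sum_of_subset_of_nonneg (Finset.filter_subset _ _) fun _ _ _ => by positivity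
    _ = Real.exp (-(a * N / 24)) * (1 + 1 / N) ^ N +
        12 * (1200 ^ h * (87 / 100) ^ N * (1 + 1 / 100 : ℝ) ^ N) := by
        rw [Finset.sum_add_distrib, ← Finset.mul_sum, ← Finset.mul_sum, sum_pow_card, sum_pow_card]
        ring
    _ ≤ _ := by
        have := mul_le_mul_of_nonneg_left h1 hT0.le
        linarith

end Sparse

/-! ### Summing the failure probabilities over all columns. -/

section Assembly

variable {p : ℕ} [Fact p.Prime] {q : ZMod p → ℝ} {a : ℝ}

lemma prefixWeight_colSeq {F : Type*} [Field F] [Fintype F] (q : F → ℝ) (N : ℕ) :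
    prefixWeight (colSeq q N) N = tupleWeight fun j : Fin N => colWeight q j := by
  unfold prefixWeight
  congr 1
  funext j
  exact colSeq_of_lt q j.2

lemma mass_dependent_succ_le_of_few (hq : IsProbWeight q) (ha0 : 0 < a) (ha : a ≤ 1 / 2)
    (hqa : ∀ r, q r ≤ 1 - a) {N k : ℕ} (hk : 4 * k < 3 * N) :
    mass (prefixWeight (colSeq q N) (k + 1)) {x | ¬ LinearIndependent (ZMod p) x} ≤
      mass (prefixWeight (colSeq q N) k) {x | ¬ LinearIndependent (ZMod p) x} +
        Real.exp (-(a * N / 4)) := by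
  have h := mass_dependent_succ_le (F := ZMod p) (isProbWeight_colSeq hq N) (k := k) ∅
    (b := Real.exp (-(a * N / 4))) (Real.exp_pos _).le (fun x hx _ => by
      rw [colSeq_of_lt q (show k < N by omega)]
      refine (mass_colWeight_submodule_le hq (by linarith) hqa _ _).trans ?_
      rw [finrank_span_eq_card hx, Fintype.card_fin]
      have h1 : 1 - a ≤ Real.exp (-a) := by
        have := Real.add_one_le_exp (-a); linarith
      refine (pow_le_pow_left₀ (by linarith) h1 _).trans ?_
      rw [← Real.exp_nat_mul]
      refine Real.exp_le_exp.2 ?_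
      have h2 : (N : ℝ) ≤ 4 * ((N - k : ℕ) : ℝ) := by
        have : N ≤ 4 * (N - k) := by omega
        exact_mod_cast this
      have h3 := mul_le_mul_of_nonneg_right h2 ha0.le
      linarith)
  simpa [mass] using h

/-- If the revealed columns are independent, not bad, and have only spread normals, some normal `w`
has mass below `τ` for every column law; its hyperplane contains the span. -/
lemma mass_dependent_succ_le_of_many (hq : IsProbWeight q) {N h k : ℕ} (hk : k < N) {τ : ℝ}
    (hτ : 0 ≤ τ) :
    mass (prefixWeight (colSeq q N) (k + 1)) {x | ¬ LinearIndependent (ZMod p) x} ≤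
      mass (prefixWeight (colSeq q N) k) {x | ¬ LinearIndependent (ZMod p) x} + τ +
        (mass (prefixWeight (colSeq q N) k) (badSet q N h τ k) +
          mass (prefixWeight (colSeq q N) k) {x | ∃ v ≠ 0, ¬ Spread h v ∧ ∀ i, v ⬝ᵥ x i = 0}) := by
  have hw := isProbWeight_colSeq hq N
  have hmain := mass_dependent_succ_le (F := ZMod p) hw (k := k)
    (badSet q N h τ k ∪ {x | ∃ v ≠ 0, ¬ Spread h v ∧ ∀ i, v ⬝ᵥ x i = 0}) hτ (fun x hx hxZ => by
      rw [colSeq_of_lt q hk]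
      simp only [Set.mem_union, not_or] at hxZ
      obtain ⟨hbad, hspread⟩ := hxZ
      simp only [badSet, Set.mem_ofPred_eq, not_and, not_forall] at hbad
      obtain ⟨w, hw0, hwx, hw⟩ := hbad hx
      have hsp : Spread h w := by
        by_contra hcon
        exact hspread ⟨w, hw0, hcon, hwx⟩
      simp only [not_exists, not_le] at hw
      exact (mass_mono (isProbWeight_colWeight hq _) (span_le_dotKer.2 hwx)).trans
        (hw hsp ⟨k, hk⟩).le)
  refine hmain.trans (add_le_add le_rfl (mass_union_le ?_ _ _))
  exact isProbWeight_prefixWeight fun i _ => hw i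

/-- The columns of the Laplacian modulo `p`, with one column and the corresponding row deleted, are
unlikely to be linearly dependent. -/
theorem mass_dependent_le (hq : IsProbWeight q) (ha : a ≤ 1 / 2) (hqa : ∀ r, q r ≤ 1 - a)
    {N : ℕ} (hN : 1 ≤ N) (haN : 10 ^ 9 * Real.log (N + 1) ≤ a * N) (hp : Real.exp N ≤ p) :
    mass (tupleWeight fun j : Fin N => colWeight q j) {x | ¬ LinearIndependent (ZMod p) x} ≤
      24 * N ^ 2 * Real.exp (-(a * N / 52428800)) := by
  have hN' : (1 : ℝ) ≤ N := by exact_mod_cast hN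
  have hlog2 : 0.69 ≤ Real.log (N + 1) := by
    have h1 : Real.log 2 ≤ Real.log (N + 1) := Real.log_le_log (by norm_num) (by linarith)
    linarith [Real.log_two_gt_d9]
  have haN1 : 10 ^ 8 ≤ a * N := by nlinarith
  have ha0 : 0 < a := by
    by_contra hcon
    push Not at hcon
    nlinarith
  have hNbig : (10 ^ 8 : ℝ) ≤ N := by nlinarith
  have hNbig' : 10 ^ 8 ≤ N := by exact_mod_cast hNbig
  set h := N / 200 with hh
  have hh200 : 200 * h ≤ N := Nat.mul_div_le N 200
  have hh400 : N ≤ 400 * h := by omega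
  have hh400' : (N : ℝ) ≤ 400 * h := by exact_mod_cast hh400
  have hhN' : (200 * h : ℝ) ≤ N := by exact_mod_cast hh200
  have hah400 : a * N ≤ 400 * (a * h) := by
    have := mul_le_mul_of_nonneg_left hh400' ha0.le
    linarith
  have hah : 1 ≤ a * h := by linarith
  have hahN : a * h ≤ N := by nlinarith
  have haNN : a * N ≤ N := by nlinarith
  -- The constant is `400 * 2 * 4 ^ 8`, from `N ≤ 400 * h` and the exponent of `θ`. Every error term
  -- is compared with `X`.
  set X := Real.exp (-(a * N / 52428800)) with hX
  have hX0 : 0 < X := Real.exp_pos _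
  set θ := Real.exp (-(a * h / 4 ^ 8 / 2)) with hθ
  have hθX : θ ≤ X := by
    refine Real.exp_le_exp.2 ?_
    have : a * h / 4 ^ 8 / 2 = a * h / 131072 := by rw [div_div]; norm_num
    rw [this]
    linarith
  have hpθ : 1 / (p : ℝ) ≤ θ := by
    have h1 : 1 / (p : ℝ) ≤ 1 / Real.exp N := one_div_le_one_div_of_le (Real.exp_pos _) hp
    refine h1.trans ?_
    rw [one_div, ← Real.exp_neg]
    refine Real.exp_le_exp.2 ?_
    have : a * h / 4 ^ 8 / 2 ≤ a * h := by
      rw [div_div]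
      exact div_le_self (by linarith) (by norm_num)
    linarith
  -- The logarithmic lower bound on `a * N` is spent here: half of the exponent absorbs `(6 / a) ^ 2
  -- * N`, where `1 / a ≤ N`.
  have hT : (6 / a) ^ 2 * Real.exp (-(a * N / 12)) ≤ Real.exp (-(a * N / 24)) / N := by
    rw [le_div_iff₀ (by linarith)]
    have h1 : Real.exp (-(a * N / 12)) = Real.exp (-(a * N / 24)) * Real.exp (-(a * N / 24)) := by
      rw [← Real.exp_add]; congr 1; ring
    have h2 : (6 / a) ≤ 6 * N := by
      rw [div_le_iff₀ ha0]; linarith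
    have h3 : ((N : ℝ) + 1) ^ 10 ≤ Real.exp (a * N / 24) := by
      rw [← Real.exp_log (show (0 : ℝ) < (N + 1) ^ 10 by positivity), Real.log_pow]
      refine Real.exp_le_exp.2 ?_
      push_cast
      linarith
    have h4 : (6 * N : ℝ) ^ 2 * N ≤ (N + 1) ^ 10 := by
      have h5 : (36 : ℝ) ≤ (N + 1) ^ 7 := by
        calc (36 : ℝ) ≤ 2 ^ 7 := by norm_num
          _ ≤ _ := pow_le_pow_left₀ (by norm_num) (by linarith) 7
      calc (6 * N : ℝ) ^ 2 * (N : ℝ) = 36 * (N : ℝ) ^ 3 := by ring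
        _ ≤ ((N : ℝ) + 1) ^ 7 * ((N : ℝ) + 1) ^ 3 :=
            mul_le_mul h5 (pow_le_pow_left₀ (by linarith) (by linarith) 3) (by positivity)
              (by positivity)
        _ = _ := by ring
    have h6 : (6 / a) ^ 2 * N * Real.exp (-(a * N / 24)) ≤ 1 := by
      have h7 : (6 / a) ^ 2 ≤ (6 * N) ^ 2 := pow_le_pow_left₀ (by positivity) h2 2
      have h8 := mul_le_mul_of_nonneg_right h7 (show (0 : ℝ) ≤ N by linarith)
      rw [Real.exp_neg, ← div_eq_mul_inv, div_le_one (Real.exp_pos _)]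
      linarith
    have h9 := mul_le_mul_of_nonneg_right h6 (Real.exp_pos (-(a * N / 24))).le
    rw [h1]
    linarith
  have hchain : ∀ k < N, mass (prefixWeight (colSeq q N) k) (badSet q N h (4 * θ) k) ≤ 4 * N * X := by
    intro k hk
    have h1 := mass_badSet_le_exp hq ha0 ha hqa (N := N) hah (4 * θ) (N - 1 - k) k (by omega)
    have h2 := mass_badSet_pred_le hq ha0 ha hqa (N := N) hN (h := h) (by omega) hpθ
    have h3 := sum_range_pow_le ha0 (by linarith) (N - 1 - k)
    have h4 : 1 / a ≤ N / 10 ^ 8 := by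
      rw [div_le_div_iff₀ ha0 (by norm_num)]
      linarith
    have h5 : Real.exp (3 * ∑ i ∈ Finset.range (N - 1 - k), (1 - a) ^ (i + 2)) ≤
        Real.exp (N / 100) := Real.exp_le_exp.2 (by linarith)
    have h6 : (1 / 4 : ℝ) ^ (N - 1) ≤ 4 * Real.exp (-N) := by
      have h7 : (1 / 4 : ℝ) ^ N ≤ Real.exp (-N) := by
        have h8 : (1 / 4 : ℝ) ≤ Real.exp (-1) := by
          rw [Real.exp_neg, ← one_div]
          exact one_div_le_one_div_of_le (Real.exp_pos _) (by linarith [Real.exp_one_lt_d9])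
        refine (pow_le_pow_left₀ (by norm_num) h8 N).trans (le_of_eq ?_)
        rw [← Real.exp_nat_mul]; congr 1; ring
      obtain ⟨M, rfl⟩ : ∃ M, N = M + 1 := ⟨N - 1, by omega⟩
      rw [pow_succ] at h7
      simp only [Nat.add_sub_cancel]
      linarith
    have h7 : Real.exp (N / 100) * Real.exp (-N) ≤ X := by
      rw [← Real.exp_add]
      exact Real.exp_le_exp.2 (by linarith)
    calc _ ≤ Real.exp (N / 100) * (N * (4 * Real.exp (-N))) := by
          refine h1.trans (mul_le_mul h5 (h2.trans ?_) (mass_nonneg ?_ _) (Real.exp_pos _).le)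
          · exact mul_le_mul_of_nonneg_left h6 (by linarith)
          · exact isProbWeight_prefixWeight fun i _ => isProbWeight_colSeq hq N i
      _ = 4 * N * (Real.exp (N / 100) * Real.exp (-N)) := by ring
      _ ≤ _ := mul_le_mul_of_nonneg_left h7 (by linarith)
  have h92 : (92 / 100 : ℝ) ^ N ≤ X := by
    have h1 : (92 / 100 : ℝ) ≤ Real.exp (-(8 / 100)) := by
      have := Real.add_one_le_exp (-(8 / 100) : ℝ); linarith
    refine (pow_le_pow_left₀ (by norm_num) h1 N).trans ?_
    rw [← Real.exp_nat_mul]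
    exact Real.exp_le_exp.2 (by linarith)
  have h24 : Real.exp (-(a * N / 24)) ≤ X := Real.exp_le_exp.2 (by linarith)
  have h4 : Real.exp (-(a * N / 4)) ≤ X := Real.exp_le_exp.2 (by linarith)
  have hNX : X ≤ N * X := le_mul_of_one_le_left hX0.le hN'
  -- A late step costs at most `4 * X` for the threshold, `4 * N * X` for the bad set and `15 * X`
  -- for nearly constant normals, which fits in `24 * N * X`.
  have hstep : ∀ k ≤ N, mass (prefixWeight (colSeq q N) k) {x | ¬ LinearIndependent (ZMod p) x} ≤
      k * (24 * N * X) := by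
    intro k
    induction k with
    | zero =>
      intro _
      have : {x : Fin 0 → Fin N → ZMod p | ¬ LinearIndependent (ZMod p) x} = ∅ := by
        ext x
        simp
      rw [this]
      simp [mass]
    | succ k ih =>
      intro hk
      have ih' := ih (by omega)
      push_cast
      by_cases hk3 : 4 * k < 3 * N
      · have := mass_dependent_succ_le_of_few hq ha0 ha hqa hk3
        linarith
      · have h1 := mass_dependent_succ_le_of_many hq (h := h) (show k < N by omega)
          (show 0 ≤ 4 * θ by positivity)
        have h2 := hchain k (by omega)
        have h3 := mass_exists_not_spread_le hq ha0 ha hqa hN (show k ≤ N by omega)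
          (not_lt.1 hk3) hh200 hT
        linarith
  rw [← prefixWeight_colSeq]
  refine (hstep N le_rfl).trans (le_of_eq ?_)
  ring

end Assembly

/-! ### From integer matrices to finite weights modulo a prime. -/

section Transfer

/-- An integer matrix has full column rank over the reals if a square part of it has independent
columns modulo a prime. -/
lemma rank_realColumns_of_linearIndependent {N p : ℕ} [Fact p.Prime]
    (A : Matrix (Fin (N + 1)) (Fin (N + 1)) ℤ) (j₀ : Fin (N + 1)) {S : Finset (Fin (N + 1))}
    (hS : ∀ j, j ∈ S ↔ j ≠ j₀)
    (h : LinearIndependent (ZMod p) fun j k : Fin N =>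
      (-(A (j₀.succAbove k) (j₀.succAbove j) : ZMod p))) :
    (realColumns A S).rank = N := by
  let B : Matrix (Fin N) (Fin N) ℤ := Matrix.of fun k j => -A (j₀.succAbove k) (j₀.succAbove j)
  have hB : IsUnit (B.map (Int.castRingHom (ZMod p))) := by
    rw [← Matrix.linearIndependent_cols_iff_isUnit]
    convert h using 1
    ext j k
    simp [B, Matrix.col]
  have hdet : B.det ≠ 0 := by
    intro h0
    rw [Matrix.isUnit_iff_isUnit_det, ← RingHom.mapMatrix_apply, ← RingHom.map_det, h0, map_zero] at hB
    exact not_isUnit_zero hB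
  have hcard : Fintype.card S = N := by
    rw [Fintype.card_coe, show S = Finset.univ.erase j₀ by ext j; simp [hS]]
    simp
  refine le_antisymm ((Matrix.rank_le_card_width _).trans hcard.le) ?_
  let c : Fin N → S := fun j => ⟨j₀.succAbove j, (hS _).2 (j₀.succAbove_ne j)⟩
  have hsub := Matrix.rank_submatrix_le (realColumns A S) j₀.succAbove c
  have hU : IsUnit ((realColumns A S).submatrix j₀.succAbove c) := by
    have h1 : (realColumns A S).submatrix j₀.succAbove c = -(B.map (Int.castRingHom ℝ)) := by
      ext k j
      simp [B, realColumns, c]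
    rw [h1, IsUnit.neg_iff, Matrix.isUnit_iff_isUnit_det, ← RingHom.mapMatrix_apply,
      ← RingHom.map_det, isUnit_iff_ne_zero]
    simpa using hdet
  rw [Matrix.rank_of_isUnit _ hU, Fintype.card_fin] at hsub
  exact hsub

/-- The independent entries of the columns other than the `j₀`-th one. -/
def entries (p : ℕ) {N : ℕ} (M : Matrix (Fin (N + 1)) (Fin (N + 1)) ℤ) (j₀ : Fin (N + 1))
    (j k : Fin N) : ZMod p :=
  (M (if k = j then j₀ else j₀.succAbove k) (j₀.succAbove j) : ZMod p)

lemma colMap_entries {p : ℕ} [Fact p.Prime] {N : ℕ} {M : Matrix (Fin (N + 1)) (Fin (N + 1)) ℤ}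
    (hM : ∀ i, M i i = 0) (j₀ : Fin (N + 1)) (j k : Fin N) :
    colMap (ZMod p) j (entries p M j₀ j) k =
      -(digraphLaplacian M (j₀.succAbove k) (j₀.succAbove j) : ZMod p) := by
  rw [colMap_apply]
  by_cases hk : k = j
  · subst hk
    have h1 : ∀ i, entries p M j₀ k i = (if i = k then (M j₀ (j₀.succAbove k) : ZMod p) else 0) +
        (M (j₀.succAbove i) (j₀.succAbove k) : ZMod p) := by
      intro i
      unfold entries
      by_cases hi : i = k <;> simp [hi, hM]
    simp only [if_true, digraphLaplacian, Matrix.of_apply, h1, Finset.sum_add_distrib]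
    rw [Fin.sum_univ_succAbove _ j₀]
    simp
  · simp [hk, digraphLaplacian, entries, j₀.succAbove_right_injective.eq_iff]

/-- The law of an integer random variable modulo `p`. -/
noncomputable def modWeight (p : ℕ) (ν : Measure ℤ) (r : ZMod p) : ℝ := ν.real {x : ℤ | (x : ZMod p) = r}

lemma isProbWeight_modWeight (p : ℕ) [NeZero p] (ν : Measure ℤ) [IsProbabilityMeasure ν] :
    IsProbWeight (modWeight p ν) where
  nonneg r := measureReal_nonneg
  sum_eq_one := by
    have h := measureReal_biUnion_finset (μ := ν) (s := (Finset.univ : Finset (ZMod p)))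
      (f := fun r => {x : ℤ | (x : ZMod p) = r})
      (by
        intro r _ r' _ hrr
        rw [Function.onFun, Set.disjoint_left]
        intro x hx hx'
        exact hrr (hx.symm.trans hx'))
      (fun r _ => MeasurableSet.of_discrete)
    unfold modWeight
    rw [← h]
    have : (⋃ r ∈ (Finset.univ : Finset (ZMod p)), {x : ℤ | (x : ZMod p) = r}) = Set.univ := by
      ext x; simp
    rw [this]
    simp

/-- Choose `R` so that the law puts at most `α / 2` outside `[-R, R]`. If `p ≥ 2 * R + 1`, each
residue class meets this interval in at most one point, so its mass exceeds that of an atom by at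
most `α / 2`. No boundedness of the law is needed. -/
lemma exists_prime_modWeight_le {ν : Measure ℤ} [IsProbabilityMeasure ν] {α : ℝ} (hα : 0 < α)
    (hα1 : α ≤ 1) (hν : ∀ x, ν.real {x} ≤ 1 - α) (T : ℝ) :
    ∃ p : ℕ, p.Prime ∧ T ≤ p ∧ ∀ r : ZMod p, modWeight p ν r ≤ 1 - α / 2 := by
  obtain ⟨R, hR⟩ : ∃ R : ℕ, ν.real (Set.Icc (-(R : ℤ)) R)ᶜ ≤ α / 2 := by
    have hmono : Monotone fun R : ℕ => Set.Icc (-(R : ℤ)) R := fun R R' h =>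
      Set.Icc_subset_Icc (by omega) (by omega)
    have h1 := tendsto_measure_iUnion_atTop (μ := ν) hmono
    have h2 : (⋃ R : ℕ, Set.Icc (-(R : ℤ)) R) = Set.univ := by
      ext x
      simp only [Set.mem_iUnion, Set.mem_Icc, Set.mem_univ, iff_true]
      exact ⟨x.natAbs, by omega, by omega⟩
    rw [h2, measure_univ] at h1
    have h3 := (ENNReal.tendsto_toReal ENNReal.one_ne_top).comp h1
    have h4 := h3.eventually (lt_mem_nhds (show 1 - α / 2 < (1 : ENNReal).toReal by simp [hα]))
    obtain ⟨R, hR⟩ := h4.exists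
    refine ⟨R, ?_⟩
    rw [probReal_compl_eq_one_sub MeasurableSet.of_discrete]
    have : 1 - α / 2 < ν.real (Set.Icc (-(R : ℤ)) R) := hR
    linarith
  obtain ⟨T', hT'⟩ := exists_nat_ge T
  obtain ⟨p, hpge, hp⟩ := Nat.exists_infinite_primes (max T' (2 * R + 1))
  refine ⟨p, hp, hT'.trans (by exact_mod_cast (le_max_left _ _).trans hpge), fun r => ?_⟩
  have hpR : 2 * R + 1 ≤ p := (le_max_right _ _).trans hpge
  unfold modWeight
  by_cases hne : ∃ x₀ : ℤ, (x₀ : ZMod p) = r ∧ x₀ ∈ Set.Icc (-(R : ℤ)) R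
  · obtain ⟨x₀, hx₀, hxR⟩ := hne
    have hsub : {x : ℤ | (x : ZMod p) = r} ⊆ {x₀} ∪ (Set.Icc (-(R : ℤ)) R)ᶜ := by
      intro x hx
      by_cases hxI : x ∈ Set.Icc (-(R : ℤ)) R
      · left
        have h1 : (x : ZMod p) = x₀ := Eq.trans hx hx₀.symm
        rw [ZMod.intCast_eq_intCast_iff_dvd_sub] at h1
        have h2 := Int.eq_zero_of_abs_lt_dvd h1 (by
          rw [abs_lt]
          simp only [Set.mem_Icc] at hxI hxR
          constructor <;> omega)
        change x = x₀
        omega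
      · right; exact hxI
    have := (measureReal_mono (μ := ν) hsub).trans (measureReal_union_le _ _)
    linarith [hν x₀]
  · have hsub : {x : ℤ | (x : ZMod p) = r} ⊆ (Set.Icc (-(R : ℤ)) R)ᶜ :=
      fun x hx hxI => hne ⟨x, hx, hxI⟩
    have := measureReal_mono (μ := ν) hsub
    linarith

variable {Ω : Type*} [MeasurableSpace Ω] {P : Measure Ω} {N : ℕ}
  {M : Ω → Matrix (Fin (N + 1)) (Fin (N + 1)) ℤ} {ν : Measure ℤ}

lemma measure_entries_eq (hM : IsRandomDigraphMatrix M ν P) (p : ℕ) (j₀ : Fin (N + 1))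
    (z : Fin N → Fin N → ZMod p) :
    P.real {ω | entries p (M ω) j₀ = z} = ∏ j, ∏ k, modWeight p ν (z j k) := by
  -- In column `j`, the slot of the vanishing diagonal entry is given to the entry from the deleted
  -- row `j₀`, which still enters the column sum. Thus all `N ^ 2` slots hold distinct off-diagonal
  -- entries.
  let g : Fin N × Fin N → {e : Fin (N + 1) × Fin (N + 1) // e.1 ≠ e.2} := fun e =>
    ⟨(if e.2 = e.1 then j₀ else j₀.succAbove e.2, j₀.succAbove e.1), by
      by_cases h : e.2 = e.1
      · simp [h]
      · simp [h]⟩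
  have hg : Function.Injective g := by
    rintro ⟨j, k⟩ ⟨j', k'⟩ h
    have h1 := congrArg (fun e => e.1.2) h
    have h2 := congrArg (fun e => e.1.1) h
    simp only [g] at h1 h2
    have hj := j₀.succAbove_right_injective h1
    subst hj
    by_cases hk : k = j <;> by_cases hk' : k' = j
    · rw [hk, hk']
    · rw [if_pos hk, if_neg hk'] at h2
      exact absurd h2.symm (j₀.succAbove_ne k')
    · rw [if_neg hk, if_pos hk'] at h2
      exact absurd h2 (j₀.succAbove_ne k)
    · rw [if_neg hk, if_neg hk'] at h2
      rw [j₀.succAbove_right_injective h2]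
  have hind := hM.indep.precomp hg
  have h := hind.measure_inter_preimage_eq_mul Finset.univ
    (sets := fun e => {x : ℤ | (x : ZMod p) = z e.1 e.2}) (fun e _ => MeasurableSet.of_discrete)
  have hset : {ω | entries p (M ω) j₀ = z} = ⋂ e ∈ (Finset.univ : Finset (Fin N × Fin N)),
      (fun ω => M ω (g e).1.1 (g e).1.2) ⁻¹' {x : ℤ | (x : ZMod p) = z e.1 e.2} := by
    ext ω
    simp only [Set.mem_ofPred_eq, funext_iff, Set.mem_iInter, Set.mem_preimage, Finset.mem_univ,
      true_implies, Prod.forall]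
    rfl
  rw [Measure.real, hset]
  erw [h]
  rw [ENNReal.toReal_prod, Fintype.prod_prod_type]
  refine Finset.prod_congr rfl fun j _ => Finset.prod_congr rfl fun k _ => ?_
  rw [modWeight, Measure.real]
  congr 1
  exact (hM.law _ _ (g (j, k)).2).measure_eq MeasurableSet.of_discrete

/-- Linear dependence of the columns of the deleted Laplacian modulo `p`, in terms of the weights of
the columns. -/
lemma measure_dependent_le [IsProbabilityMeasure P] (hM : IsRandomDigraphMatrix M ν P) (p : ℕ) [Fact p.Prime] (j₀ : Fin (N + 1)) :
    P.real {ω | ¬ LinearIndependent (ZMod p) fun j k : Fin N =>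
      (-(digraphLaplacian (M ω) (j₀.succAbove k) (j₀.succAbove j) : ZMod p))} ≤
      mass (tupleWeight fun j : Fin N => colWeight (modWeight p ν) j)
        {x | ¬ LinearIndependent (ZMod p) x} := by
  classical
  let e : (Fin N → Fin N → ZMod p) ≃ (Fin N → Fin N → ZMod p) :=
    Equiv.piCongrRight fun j => (colMap (ZMod p) j).toEquiv
  rw [← mass_comp_equiv e]
  set D : Set (Fin N → Fin N → ZMod p) := e ⁻¹' {x | ¬ LinearIndependent (ZMod p) x} with hD
  have hset : {ω | ¬ LinearIndependent (ZMod p) fun j k : Fin N =>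
      (-(digraphLaplacian (M ω) (j₀.succAbove k) (j₀.succAbove j) : ZMod p))} ⊆
      ⋃ z ∈ Finset.univ.filter fun z => z ∈ D, {ω | entries p (M ω) j₀ = z} := by
    intro ω hω
    simp only [Set.mem_iUnion, Finset.mem_filter, Finset.mem_univ, true_and]
    refine ⟨entries p (M ω) j₀, ?_, rfl⟩
    change ¬ LinearIndependent (ZMod p) _
    have : e (entries p (M ω) j₀) = fun j k : Fin N =>
        (-(digraphLaplacian (M ω) (j₀.succAbove k) (j₀.succAbove j) : ZMod p)) := by
      funext j k
      exact colMap_entries (hM.diag_eq_zero ω) j₀ j k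
    rw [this]
    exact hω
  refine (measureReal_mono hset (measure_ne_top _ _)).trans ((measureReal_biUnion_finset_le _ _).trans (le_of_eq ?_))
  rw [mass, Finset.sum_filter]
  refine Finset.sum_congr rfl fun z _ => ?_
  by_cases hz : z ∈ D
  · rw [if_pos hz, Set.indicator_of_mem hz, measure_entries_eq hM]
    refine Finset.prod_congr rfl fun j _ => ?_
    change _ = iidWeight (modWeight p ν) N (colMap (ZMod p) j (colMap (ZMod p) j (z j)))
    rw [colMap_colMap]
    rfl
  · rw [if_neg hz, Set.indicator_of_notMem hz]

end Transfer

end LaplacianRank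

/-! ### Union bound over the omitted column. -/

open LaplacianRank

theorem mainTheorem12 :
    ∃ C₀ c₀ K₀ : ℝ, 0 < C₀ ∧ 0 < c₀ ∧ 0 < K₀ ∧
      ∀ (n : ℕ), 1 ≤ n →
      ∀ (ν : Measure ℤ) [IsProbabilityMeasure ν] (α : ℝ),
        IsGreatest (Set.range fun x : ℤ => ν.real {x}) (1 - α) →
        1 - α ≤ 1 - C₀ * Real.log n / n →
      ∀ {Ω : Type*} [MeasurableSpace Ω] (P : Measure Ω) [IsProbabilityMeasure P]
        (M : Ω → Matrix (Fin n) (Fin n) ℤ), IsRandomDigraphMatrix M ν P →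
        1 - K₀ * Real.exp (-c₀ * α * n) ≤
          P.real {ω | ∀ S : Finset (Fin n), S.card = n - 1 →
            (realColumns (digraphLaplacian (M ω)) S).rank = n - 1} := by
  -- Since `a = α / 2` and `N ≥ (N + 1) / 2`, a factor 4 is lost in passing from `α * n` to `a * N`.
  -- A further factor 2 in `c₀` absorbs the polynomial `(N + 1) ^ 3`, so `419430400 = 8 * 52428800`.
  refine ⟨4 * 10 ^ 9, 1 / 419430400, 24, by norm_num, by norm_num, by norm_num, ?_⟩
  intro n hn ν _ α hgreat hα Ω _ P _ M hM
  obtain ⟨N, rfl⟩ : ∃ N, n = N + 1 := ⟨n - 1, by omega⟩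
  simp only [Nat.add_sub_cancel]
  rcases Nat.eq_zero_or_pos N with rfl | hN
  · have : {ω | ∀ S : Finset (Fin (0 + 1)), S.card = 0 →
        (realColumns (digraphLaplacian (M ω)) S).rank = 0} = Set.univ := by
      ext ω
      simp only [Set.mem_ofPred_eq, Set.mem_univ, iff_true]
      intro S hS
      have := Matrix.rank_le_card_width (realColumns (digraphLaplacian (M ω)) S)
      rw [Fintype.card_coe, hS] at this
      omega
    rw [this, probReal_univ]
    linarith [Real.exp_pos (-(1 / 419430400) * α * ((0 + 1 : ℕ) : ℝ))]
  have hN' : (1 : ℝ) ≤ N := by exact_mod_cast hN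
  have hlog : 0 < Real.log (N + 1) := Real.log_pos (by linarith)
  push_cast at hα ⊢
  have hα2 : 4 * 10 ^ 9 * Real.log (N + 1) ≤ α * (N + 1) := by
    rw [← div_le_iff₀ (by linarith)]
    linarith
  have hα0 : 0 < α := by
    by_contra hcon
    push Not at hcon
    nlinarith
  have hα1 : α ≤ 1 := by
    obtain ⟨x, hx⟩ := hgreat.1
    have : 0 ≤ ν.real {x} := measureReal_nonneg
    simp only at hx
    linarith
  have hαN : α * (N + 1) ≤ 4 * (α / 2 * N) := by nlinarith
  obtain ⟨p, hp, hpT, hpw⟩ := exists_prime_modWeight_le hα0 hα1 (fun x => hgreat.2 ⟨x, rfl⟩) (Real.exp N)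
  have : Fact p.Prime := ⟨hp⟩
  have hdep := mass_dependent_le (isProbWeight_modWeight p ν) (a := α / 2) (by linarith) hpw hN
    (by linarith) hpT
  set G : Set Ω := {ω | ∀ S : Finset (Fin (N + 1)), S.card = N →
    (realColumns (digraphLaplacian (M ω)) S).rank = N}
  have hbad : Gᶜ ⊆ ⋃ j₀ ∈ (Finset.univ : Finset (Fin (N + 1))),
      {ω | ¬ LinearIndependent (ZMod p) fun j k : Fin N =>
        (-(digraphLaplacian (M ω) (j₀.succAbove k) (j₀.succAbove j) : ZMod p))} := by
    intro ω hω
    simp only [Set.mem_iUnion, Finset.mem_univ, exists_const]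
    by_contra hcon
    push Not at hcon
    refine hω fun S hS => ?_
    have hSc : Sᶜ.card = 1 := by rw [Finset.card_compl, hS]; simp
    obtain ⟨j₀, hj₀⟩ := Finset.card_eq_one.1 hSc
    refine rank_realColumns_of_linearIndependent (p := p) _ j₀ (fun j => ?_)
      (not_not.1 fun h => hcon j₀ h)
    rw [← not_iff_not, not_not, ← Finset.mem_compl, hj₀, Finset.mem_singleton]
  have hPbad : P.real Gᶜ ≤ (N + 1) * (24 * N ^ 2 * Real.exp (-(α / 2 * N / 52428800))) := by
    refine (measureReal_mono hbad (measure_ne_top _ _)).trans ((measureReal_biUnion_finset_le _ _).trans ?_)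
    refine (Finset.sum_le_card_nsmul _ _ _ fun j₀ _ =>
      (measure_dependent_le hM p j₀).trans hdep).trans (le_of_eq ?_)
    simp
  have htotal : 1 ≤ P.real G + P.real Gᶜ := by
    rw [← probReal_univ (μ := P), ← Set.union_compl_self G]
    exact measureReal_union_le _ _
  have hfinal : (N + 1) * (24 * N ^ 2 * Real.exp (-(α / 2 * N / 52428800))) ≤
      24 * Real.exp (-(1 / 419430400) * α * (N + 1)) := by
    have h1 : ((N : ℝ) + 1) ^ 3 ≤ Real.exp (α * (N + 1) / 419430400) := by
      rw [← Real.exp_log (show (0 : ℝ) < (N + 1) ^ 3 by positivity), Real.log_pow]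
      refine Real.exp_le_exp.2 ?_
      push_cast
      linarith
    have h2 : ((N : ℝ) + 1) * N ^ 2 ≤ (N + 1) ^ 3 := by nlinarith
    have h3 : Real.exp (-(α / 2 * N / 52428800)) ≤ Real.exp (-(α * (N + 1) / 209715200)) :=
      Real.exp_le_exp.2 (by linarith)
    calc _ = 24 * (((N : ℝ) + 1) * N ^ 2 * Real.exp (-(α / 2 * N / 52428800))) := by ring
      _ ≤ 24 * (Real.exp (α * (N + 1) / 419430400) * Real.exp (-(α * (N + 1) / 209715200))) := by
          refine mul_le_mul_of_nonneg_left ?_ (by norm_num)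
          exact mul_le_mul (h2.trans h1) h3 (Real.exp_pos _).le (Real.exp_pos _).le
      _ = _ := by
          rw [← Real.exp_add]
          congr 2
          ring
  linarith
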